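/- **Theorem (Co-Lagrangian sections).** Let $\mathcal F$ be a regular foliation on a smooth manifold $L$, let $V$ be a smooth real vector bundle of finite rank over $L$, let $T\mathcal F\subset TL$ be the tangent bundle of $\mathcal F$, $T^*\mathcal F$ its dual bundle, and let $\pi: M=T^*\mathcal F\oplus V\to L$ be the total space. The *canonical Dirac structure* $\mathcal D\subset TM\oplus T^*M$ is the one whose characteristic leaves are $S=\pi^{-1}(N)=T^*N\oplus V|_N$, for the leaves $N$ of $\mathcal F$, with presymplectic form $\omega_S$ on $S$ the pull-back of the standard symplectic form of $T^*N$ under the projection $T^*N\oplus V|_N\to T^*N$; explicitly, for $z\in S$, $$\mathcal D(z)=\{(X,\alpha) : X\in T_zS,\ \alpha(Y)=\omega_S(X,Y)\ \text{for all } Y\in T_zS\}.$$ For a regular Dirac structure $\mathcal D$ of bi-corank $(r,s)$ on $M$ (that is, $\dim(\mathcal D(x)\cap T_xM)=r$ and $\dim(\mathcal D(x)\cap T_x^*M)=s$ for all $x$), a submanifold $K\subset M$ is *co-Lagrangian* if $\dim K=\tfrac12(\dim M-r+s)$ and, for every $x\in K$: (a) $T_xK+\mathrm{proj}_{TM}\mathcal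 D(x)=T_xM$; (b) $T_xK\cap(T_xM\cap\mathcal D(x))=\{0\}$; (c) $\omega_S$ vanishes on $T_xK\cap T_xS$, where $S$ is the characteristic leaf through $x$. Then a smooth section $K$ of the vector bundle $T^*\mathcal F\oplus V$ is (has as its image) a co-Lagrangian submanifold of $T^*\mathcal F\oplus V$ with the canonical Dirac structure if and only if $K=(\theta,v)$, where $\theta\in\Gamma(T^*\mathcal F)$ is a smooth section with $d_{\mathcal F}\theta=0$ ($d_{\mathcal F}$ being the exterior derivative along the leaves of $\mathcal F$), and $v\in\Gamma(V)$ is an arbitrary smooth section. -/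

import Mathlib

open Bundle Set
open scoped Manifold ContDiff Topology

noncomputable section

/-- A regular (smooth) foliation of a manifold `M`, with leaves of dimension `dim P` and of
codimension `dim Q`. It is a field of tangent subspaces (the tangent spaces of the leaves) together
with, around every point `x`, a smooth foliated chart `chart x` with values in `P × Q`, on whose
domain the tangent spaces of the leaves are the spaces spanned by the `P`-directions; the plaques
are thus the sets on which the `Q`-component of the chart is constant. As for `chartAt`, one
foliated chart around each point is singled out; the bundles below and the leafwise exterior
derivative of smooth leafwise forms do not depend on this choice. -/
structure RegularFoliation {E : Type*} [NormedAddCommGroup E] [NormedSpace ℝ E]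
    {H : Type*} [TopologicalSpace H] (I : ModelWithCorners ℝ E H)
    (P Q : Type*) [NormedAddCommGroup P] [NormedSpace ℝ P]
    [NormedAddCommGroup Q] [NormedSpace ℝ Q]
    (M : Type*) [TopologicalSpace M] [ChartedSpace H M] where
  /-- The tangent space at `x` of the leaf through `x`. -/
  tangent : ∀ x : M, Submodule ℝ (TangentSpace I x)
  /-- A foliated chart around `x`. -/
  chart : M → OpenPartialHomeomorph M (P × Q)
  mem_chart_source : ∀ x, x ∈ (chart x).source
  contMDiffOn_chart : ∀ x, ContMDiffOn I 𝓘(ℝ, P × Q) ∞ (chart x) (chart x).source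
  contMDiffOn_chart_symm :
    ∀ x, ContMDiffOn 𝓘(ℝ, P × Q) I ∞ (chart x).symm (chart x).target
  mem_tangent_iff : ∀ x, ∀ y ∈ (chart x).source, ∀ v : TangentSpace I y,
    v ∈ tangent y ↔ (mfderiv I 𝓘(ℝ, P × Q) (chart x) y v : P × Q).2 = 0

namespace RegularFoliation

variable {E : Type*} [NormedAddCommGroup E] [NormedSpace ℝ E]
  {H : Type*} [TopologicalSpace H] {I : ModelWithCorners ℝ E H}
  {P Q : Type*} [NormedAddCommGroup P] [NormedSpace ℝ P]
  [NormedAddCommGroup Q] [NormedSpace ℝ Q]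
  {M : Type*} [TopologicalSpace M] [ChartedSpace H M]
  (F : RegularFoliation I P Q M)

lemma mdifferentiable_chart (x : M) : (F.chart x).MDifferentiable I 𝓘(ℝ, P × Q) :=
  ⟨(F.contMDiffOn_chart x).mdifferentiableOn (by simp),
    (F.contMDiffOn_chart_symm x).mdifferentiableOn (by simp)⟩

/-- The fiber at `x` of the tangent bundle `TF` of the foliation. -/
def Tangent (x : M) : Type _ := F.tangent x

instance (x : M) : AddCommGroup (F.Tangent x) := inferInstanceAs (AddCommGroup (F.tangent x))
instance (x : M) : Module ℝ (F.Tangent x) := inferInstanceAs (Module ℝ (F.tangent x))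
instance (x : M) : TopologicalSpace (F.Tangent x) :=
  inferInstanceAs (TopologicalSpace (F.tangent x))
instance (x : M) : IsTopologicalAddGroup (F.Tangent x) :=
  inferInstanceAs (IsTopologicalAddGroup (F.tangent x))
instance (x : M) : ContinuousSMul ℝ (F.Tangent x) :=
  inferInstanceAs (ContinuousSMul ℝ (F.tangent x))

/-- The inclusion `T_xF → T_xM`. -/
def incl (x : M) : F.Tangent x →L[ℝ] TangentSpace I x := (F.tangent x).subtypeL

lemma incl_injective (x : M) : Function.Injective (F.incl x) := Subtype.val_injective

lemma incl_mem (x : M) (v : F.Tangent x) : F.incl x v ∈ F.tangent x := v.2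

lemma isInducing_incl (x : M) : Topology.IsInducing (F.incl x) := Topology.IsInducing.subtypeVal

/-- A continuous linear map into `T_xM` with values in `T_xF`, as a map into `T_xF`. -/
def restrict {x : M} {A : Type*} [AddCommGroup A] [Module ℝ A] [TopologicalSpace A]
  (f : A →L[ℝ] TangentSpace I x) (hf : ∀ a, f a ∈ F.tangent x) : A →L[ℝ] F.Tangent x :=
  f.codRestrict (F.tangent x) hf

@[simp] lemma incl_restrict {x : M} {A : Type*} [AddCommGroup A] [Module ℝ A] [TopologicalSpace A]
  (f : A →L[ℝ] TangentSpace I x) (hf : ∀ a, f a ∈ F.tangent x) (a : A) :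
  F.incl x (F.restrict f hf a) = f a := rfl

/-- The derivative at `y` of the chart chosen at `x`, with values in `P × Q`. -/
def chartDeriv (x y : M) : TangentSpace I y →L[ℝ] P × Q :=
  mfderiv I 𝓘(ℝ, P × Q) (F.chart x) y

/-- The derivative of the inverse of the chart chosen at `x`, at the image of `y`. -/
def chartDerivSymm (x y : M) : P × Q →L[ℝ] TangentSpace I y :=
  mfderiv 𝓘(ℝ, P × Q) I (F.chart x).symm (F.chart x y)

lemma chartDeriv_chartDerivSymm {x y : M} (hy : y ∈ (F.chart x).source) (w : P × Q) :
    F.chartDeriv x y (F.chartDerivSymm x y w) = w :=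
  ((F.mdifferentiable_chart x).mfderiv hy).apply_symm_apply w

lemma chartDerivSymm_chartDeriv {x y : M} (hy : y ∈ (F.chart x).source) (v : TangentSpace I y) :
    F.chartDerivSymm x y (F.chartDeriv x y v) = v :=
  ((F.mdifferentiable_chart x).mfderiv hy).symm_apply_apply v

lemma mem_tangent_iff_chartDeriv {x y : M} (hy : y ∈ (F.chart x).source) (v : TangentSpace I y) :
    v ∈ F.tangent y ↔ (F.chartDeriv x y v).2 = 0 := F.mem_tangent_iff x y hy v

/-- The isomorphism `T_yF → P` given by the derivative of the foliated chart chosen at `x`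
(for `y` in the domain of that chart). -/
def leafCoord (x y : M) : F.Tangent y →L[ℝ] P :=
  (ContinuousLinearMap.fst ℝ P Q).comp ((F.chartDeriv x y).comp (F.incl y))

lemma leafFrame_aux {x y : M} (hy : y ∈ (F.chart x).source) (a : P) :
    ((F.chartDerivSymm x y).comp (ContinuousLinearMap.inl ℝ P Q)) a ∈ F.tangent y := by
  rw [F.mem_tangent_iff_chartDeriv hy, ContinuousLinearMap.comp_apply,
    F.chartDeriv_chartDerivSymm hy, ContinuousLinearMap.inl_apply]

open Classical in
/-- The inverse `P → T_yF` of `leafCoord x y`, for `y` in the domain of the foliated chart chosen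
at `x` (and zero outside that domain). -/
def leafFrame (x y : M) : P →L[ℝ] F.Tangent y :=
  if hy : y ∈ (F.chart x).source then
    F.restrict ((F.chartDerivSymm x y).comp (ContinuousLinearMap.inl ℝ P Q)) (F.leafFrame_aux hy)
  else 0

lemma incl_leafFrame {x y : M} (hy : y ∈ (F.chart x).source) (a : P) :
    F.incl y (F.leafFrame x y a) = F.chartDerivSymm x y (a, 0) := by
  rw [leafFrame, dif_pos hy]; rfl

lemma leafCoord_apply (x y : M) (v : F.Tangent y) :
    F.leafCoord x y v = (F.chartDeriv x y (F.incl y v)).1 := rfl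

lemma leafCoord_leafFrame {x y : M} (hy : y ∈ (F.chart x).source) (a : P) :
    F.leafCoord x y (F.leafFrame x y a) = a := by
  rw [leafCoord_apply, F.incl_leafFrame hy, F.chartDeriv_chartDerivSymm hy]

lemma leafFrame_leafCoord {x y : M} (hy : y ∈ (F.chart x).source) (v : F.Tangent y) :
    F.leafFrame x y (F.leafCoord x y v) = v := by
  apply F.incl_injective
  have h := (F.mem_tangent_iff_chartDeriv hy _).1 (F.incl_mem y v)
  rw [F.incl_leafFrame hy, leafCoord_apply, ← h]
  exact F.chartDerivSymm_chartDeriv hy _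

/-- The local trivialization of `TF` over the domain of the foliated chart chosen at `x`. -/
def pretrivialization (x : M) : Pretrivialization P (π P F.Tangent) where
  toFun z := (z.1, F.leafCoord x z.1 z.2)
  invFun w := ⟨w.1, F.leafFrame x w.1 w.2⟩
  source := π P F.Tangent ⁻¹' (F.chart x).source
  target := (F.chart x).source ×ˢ univ
  map_source' z hz := ⟨hz, mem_univ _⟩
  map_target' w hw := hw.1
  left_inv' z hz := by
    obtain ⟨y, v⟩ := z
    simp only [F.leafFrame_leafCoord (x := x) (y := y) hz]
  right_inv' w hw := by
    simp only [F.leafCoord_leafFrame hw.1]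
  open_target := (F.chart x).open_source.prod isOpen_univ
  baseSet := (F.chart x).source
  open_baseSet := (F.chart x).open_source
  source_eq := rfl
  target_eq := rfl
  proj_toFun _ _ := rfl

instance (x : M) : (F.pretrivialization x).IsLinear ℝ where
  linear y _ := (F.leafCoord x y).toLinearMap.isLinear

/-- The change of coordinates between two of these local trivializations. -/
def coordChange (x x' y : M) : P →L[ℝ] P := (F.leafCoord x' y).comp (F.leafFrame x y)

lemma coordChange_apply {x x' y : M} (hy : y ∈ (F.chart x).source)
    (v : P) :
    F.coordChange x x' y v =
      (F.pretrivialization x' ⟨y, (F.pretrivialization x).symm y v⟩).2 := by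
  rw [Pretrivialization.symm_apply _ hy]; rfl

lemma contMDiffOn_coordChange (x x' : M) : ContMDiffOn I 𝓘(ℝ, P →L[ℝ] P) ∞ (F.coordChange x x')
    ((F.chart x).source ∩ (F.chart x').source) := by
  set e := F.chart x
  set e' := F.chart x'
  have ho : IsOpen (e.symm ≫ₕ e').source := (e.symm ≫ₕ e').open_source
  have h1 : ContDiffOn ℝ ∞ (e' ∘ e.symm) (e.symm ≫ₕ e').source := by
    rw [← contMDiffOn_iff_contDiffOn]
    exact (F.contMDiffOn_chart x').comp ((F.contMDiffOn_chart_symm x).mono fun z hz => by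
      simp only [mfld_simps] at hz; exact hz.1) fun z hz => by
      simp only [mfld_simps] at hz; exact hz.2
  have h2 : ContDiffOn ℝ ∞ (fun z => (ContinuousLinearMap.fst ℝ P Q).comp
      ((fderiv ℝ (e' ∘ e.symm) z).comp (ContinuousLinearMap.inl ℝ P Q)))
      (e.symm ≫ₕ e').source := by
    have := h1.fderiv_of_isOpen ho (m := ∞) (by simp)
    exact contDiffOn_const.clm_comp (this.clm_comp contDiffOn_const)
  have h3 := (contMDiffOn_iff_contDiffOn.2 h2).comp
    ((F.contMDiffOn_chart x).mono (inter_subset_left (t := e'.source))) (fun y hy => by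
      simp only [mfld_simps]
      exact ⟨e.map_source hy.1, by rw [e.left_inv hy.1]; exact hy.2⟩)
  refine h3.congr fun y hy => ?_
  ext a
  have hcomp : ∀ w : P × Q, fderiv ℝ (e' ∘ e.symm) (e y) w =
      F.chartDeriv x' y (F.chartDerivSymm x y w) := by
    intro w
    have hd' : MDifferentiableAt I 𝓘(ℝ, P × Q) e' (e.symm (e y)) := by
      rw [e.left_inv hy.1]; exact (F.mdifferentiable_chart x').mdifferentiableAt hy.2
    have h := mfderiv_comp (e y) hd'
      ((F.mdifferentiable_chart x).mdifferentiableAt_symm (e.map_source hy.1))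
    rw [e.left_inv hy.1, mfderiv_eq_fderiv] at h
    rw [h]; rfl
  rw [coordChange, ContinuousLinearMap.comp_apply, leafCoord_apply, F.incl_leafFrame hy.1,
    ← hcomp]
  rfl

/-- The vector bundle structure of `TF`. -/
@[reducible] def prebundle : VectorPrebundle ℝ P F.Tangent where
  pretrivializationAtlas := range F.pretrivialization
  pretrivialization_linear' := by rintro _ ⟨x, rfl⟩; infer_instance
  pretrivializationAt := F.pretrivialization
  mem_base_pretrivializationAt := F.mem_chart_source
  pretrivialization_mem_atlas x := ⟨x, rfl⟩
  exists_coordChange := by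
    rintro _ ⟨x, rfl⟩ _ ⟨x', rfl⟩
    exact ⟨F.coordChange x x', (F.contMDiffOn_coordChange x x').continuousOn,
      fun y hy v => F.coordChange_apply hy.1 v⟩
  totalSpaceMk_isInducing y := by
    have hy := F.mem_chart_source y
    have : Topology.IsInducing (F.leafCoord y y) :=
      (ContinuousLinearEquiv.equivOfInverse (F.leafCoord y y) (F.leafFrame y y)
        (F.leafFrame_leafCoord hy) (F.leafCoord_leafFrame hy)).toHomeomorph.isInducing
    exact Topology.isInducing_const_prod.2 this

instance : TopologicalSpace (TotalSpace P F.Tangent) := F.prebundle.totalSpaceTopology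
instance : FiberBundle P F.Tangent := F.prebundle.toFiberBundle
instance : VectorBundle ℝ P F.Tangent := F.prebundle.toVectorBundle
instance : F.prebundle.IsContMDiff I ∞ where
  exists_contMDiffCoordChange := by
    rintro _ ⟨x, rfl⟩ _ ⟨x', rfl⟩
    exact ⟨F.coordChange x x', F.contMDiffOn_coordChange x x',
      fun y hy v => F.coordChange_apply hy.1 v⟩
instance : ContMDiffVectorBundle ∞ P F.Tangent I := F.prebundle.contMDiffVectorBundle I

/-- The fiber at `x` of the cotangent bundle `T*F` of the foliation: the dual of `T_xF`. The
smooth vector bundle structure of `T*F` is that of the bundle of linear maps from `TF` to the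
trivial line bundle. -/
abbrev Cotangent (x : M) : Type _ := F.Tangent x →L[ℝ] Bundle.Trivial M ℝ x


section Pullback

variable (A : Type*) [NormedAddCommGroup A] [NormedSpace ℝ A] (W : M → Type*)
  [TopologicalSpace (TotalSpace A W)] [∀ x, AddCommGroup (W x)] [∀ x, Module ℝ (W x)]
  [∀ x, TopologicalSpace (W x)] [FiberBundle A W] [VectorBundle ℝ A W]

/-- The permutation of factors `(P × Q) × A ≃ (P × A) × Q`. -/
def shuffle (P Q A : Type*) [NormedAddCommGroup P] [NormedSpace ℝ P] [NormedAddCommGroup Q]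
    [NormedSpace ℝ Q] [NormedAddCommGroup A] [NormedSpace ℝ A] :
    ((P × Q) × A) ≃L[ℝ] (P × A) × Q where
  toFun w := ((w.1.1, w.2), w.1.2)
  invFun w := ((w.1.1, w.2), w.1.2)
  map_add' _ _ := rfl
  map_smul' _ _ := rfl
  left_inv _ := rfl
  right_inv _ := rfl
  continuous_toFun := by fun_prop
  continuous_invFun := by fun_prop

/-- The chart of the total space of a vector bundle `W` obtained from a local trivialization of `W`
and a foliated chart of the base: `(x, w) ↦ ((p, a), q)`, where `(p, q)` are the coordinates of `x`
and `a` are those of `w`. -/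
def liftChart (x : M) : OpenPartialHomeomorph (TotalSpace A W) ((P × A) × Q) :=
  ((trivializationAt A W x).toOpenPartialHomeomorph ≫ₕ
    (F.chart x).prod (OpenPartialHomeomorph.refl A)).transHomeomorph
      (shuffle P Q A).toHomeomorph

lemma liftChart_apply (x : M) (z : TotalSpace A W) (hz : z.1 ∈ (trivializationAt A W x).baseSet) :
    F.liftChart A W x z =
      (((F.chart x z.1).1, (trivializationAt A W x z).2), (F.chart x z.1).2) := by
  have h := (trivializationAt A W x).coe_fst' hz
  change shuffle P Q A (F.chart x (trivializationAt A W x z).1, (trivializationAt A W x z).2) = _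
  rw [h]; rfl

lemma mem_liftChart_source (x : M) (z : TotalSpace A W) :
    z ∈ (F.liftChart A W x).source ↔
      z.1 ∈ (trivializationAt A W x).baseSet ∧ z.1 ∈ (F.chart x).source := by
  change z ∈ ((trivializationAt A W x).toOpenPartialHomeomorph ≫ₕ
    (F.chart x).prod (OpenPartialHomeomorph.refl A)).source ↔ _
  simp only [mfld_simps, Trivialization.mem_source]
  refine and_congr_right fun h => ?_
  rw [(trivializationAt A W x).coe_fst' h]

lemma mem_liftChart_target (x : M) (w : (P × A) × Q) :
    w ∈ (F.liftChart A W x).target ↔ (w.1.1, w.2) ∈ (F.chart x).target ∧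
      (F.chart x).symm (w.1.1, w.2) ∈ (trivializationAt A W x).baseSet := by
  change ((w.1.1, w.2), w.1.2) ∈ ((trivializationAt A W x).toOpenPartialHomeomorph ≫ₕ
    (F.chart x).prod (OpenPartialHomeomorph.refl A)).target ↔ _
  simp only [mfld_simps, Trivialization.mem_target]

lemma liftChart_symm_apply (x : M) (w : (P × A) × Q) :
    (F.liftChart A W x).symm w = (trivializationAt A W x).toOpenPartialHomeomorph.symm
      ((F.chart x).symm (w.1.1, w.2), w.1.2) := rfl

lemma contMDiffOn_liftChart [ContMDiffVectorBundle ∞ A W I] (x : M) :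
    ContMDiffOn (I.prod 𝓘(ℝ, A)) 𝓘(ℝ, (P × A) × Q) ∞ (F.liftChart A W x)
      (F.liftChart A W x).source := by
  have h1 : ContMDiffOn (I.prod 𝓘(ℝ, A)) 𝓘(ℝ, P × Q) ∞ (fun y : TotalSpace A W =>
      F.chart x y.1) (F.liftChart A W x).source :=
    (F.contMDiffOn_chart x).comp (contMDiffOn_proj W)
      (fun y hy => ((F.mem_liftChart_source A W _ y).1 hy).2)
  have h2 : ContMDiffOn (I.prod 𝓘(ℝ, A)) 𝓘(ℝ, A) ∞ (fun y : TotalSpace A W =>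
      (trivializationAt A W x y).2) (F.liftChart A W x).source :=
    contMDiff_snd.comp_contMDiffOn
      (((trivializationAt A W x).contMDiffOn (IB := I) (n := ∞)).mono fun y hy =>
        (Trivialization.mem_source _).2 ((F.mem_liftChart_source A W _ y).1 hy).1)
  refine ((shuffle P Q A).contDiff.contMDiff.comp_contMDiffOn (h1.prodMk_space h2)).congr
    fun y hy => ?_
  exact F.liftChart_apply A W _ y ((F.mem_liftChart_source A W _ y).1 hy).1

lemma contMDiffOn_liftChart_symm [ContMDiffVectorBundle ∞ A W I] (x : M) :
    ContMDiffOn 𝓘(ℝ, (P × A) × Q) (I.prod 𝓘(ℝ, A)) ∞ (F.liftChart A W x).symm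
      (F.liftChart A W x).target := by
  have h1 : ContMDiffOn 𝓘(ℝ, (P × A) × Q) I ∞ (fun w : (P × A) × Q =>
      (F.chart x).symm (w.1.1, w.2)) (F.liftChart A W x).target :=
    (F.contMDiffOn_chart_symm x).comp
      (ContDiff.contMDiff (by fun_prop)).contMDiffOn
      (fun w hw => ((F.mem_liftChart_target A W _ w).1 hw).1)
  have h2 : ContMDiffOn 𝓘(ℝ, (P × A) × Q) 𝓘(ℝ, A) ∞ (fun w : (P × A) × Q =>
      w.1.2) (F.liftChart A W x).target :=
    (ContDiff.contMDiff (by fun_prop)).contMDiffOn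
  exact ((trivializationAt A W x).contMDiffOn_symm (IB := I) (n := ∞)).comp (h1.prodMk h2)
    (fun w hw => (Trivialization.mem_target _).2 ((F.mem_liftChart_target A W _ w).1 hw).2)

lemma mfderiv_liftChart_snd [ContMDiffVectorBundle ∞ A W I] (x : M) (y : TotalSpace A W)
    (hy : y ∈ (F.liftChart A W x).source) (v : TangentSpace (I.prod 𝓘(ℝ, A)) y) :
    (mfderiv (I.prod 𝓘(ℝ, A)) 𝓘(ℝ, (P × A) × Q) (F.liftChart A W x) y v : (P × A) × Q).2 =
      (F.chartDeriv x y.1 (mfderiv (I.prod 𝓘(ℝ, A)) I (π A W) y v)).2 := by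
  have hs := ((F.mem_liftChart_source A W _ y).1 hy).2
  have hnhds : (F.liftChart A W x).source ∈ 𝓝 y := (F.liftChart A W x).open_source.mem_nhds hy
  have hd : MDifferentiableAt (I.prod 𝓘(ℝ, A)) 𝓘(ℝ, (P × A) × Q) (F.liftChart A W x) y :=
    ((F.contMDiffOn_liftChart A W x).contMDiffAt hnhds).mdifferentiableAt (by simp)
  have hp : MDifferentiableAt (I.prod 𝓘(ℝ, A)) I (π A W) y :=
    (contMDiffAt_proj (n := ∞) W).mdifferentiableAt (by simp)
  have hc := (F.mdifferentiable_chart x).mdifferentiableAt hs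
  have e1 := (ContinuousLinearMap.snd ℝ (P × A) Q).hasMFDerivAt.comp y hd.hasMFDerivAt
  have e2 := (ContinuousLinearMap.snd ℝ P Q).hasMFDerivAt.comp y
    (hc.hasMFDerivAt.comp y hp.hasMFDerivAt)
  have e3 := e2.congr_of_eventuallyEq (f₁ := ContinuousLinearMap.snd ℝ (P × A) Q ∘
    F.liftChart A W x) (by
      filter_upwards [hnhds] with w hw
      simp only [Function.comp_apply]
      rw [F.liftChart_apply A W x w ((F.mem_liftChart_source A W _ w).1 hw).1]
      rfl)
  exact DFunLike.congr_fun (hasMFDerivAt_unique e1 e3) v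

/-- The foliation of the total space of a vector bundle `π : W → M` whose leaves are the preimages
`π⁻¹(N)` of the leaves `N` of the foliation of `M`. -/
def pullback [ContMDiffVectorBundle ∞ A W I] :
    RegularFoliation (I.prod 𝓘(ℝ, A)) (P × A) Q (TotalSpace A W) where
  tangent z := (F.tangent z.1).comap
    (mfderiv (I.prod 𝓘(ℝ, A)) I (π A W) z).toLinearMap
  chart z := F.liftChart A W z.1
  mem_chart_source z := (F.mem_liftChart_source A W _ z).2
    ⟨mem_baseSet_trivializationAt A W z.1, F.mem_chart_source z.1⟩
  contMDiffOn_chart z := F.contMDiffOn_liftChart A W z.1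
  contMDiffOn_chart_symm z := F.contMDiffOn_liftChart_symm A W z.1
  mem_tangent_iff z y hy v := by
    rw [F.mfderiv_liftChart_snd A W z.1 y hy v,
      ← F.mem_tangent_iff_chartDeriv ((F.mem_liftChart_source A W _ y).1 hy).2]
    rfl

/-- The derivative of the projection `π : W → M`, from the leaves `π⁻¹(N)` to the leaves `N`. -/
def tangentProj [ContMDiffVectorBundle ∞ A W I] (z : TotalSpace A W) :
    (F.pullback A W).Tangent z →L[ℝ] F.Tangent z.1 :=
  F.restrict ((mfderiv (I.prod 𝓘(ℝ, A)) I (π A W) z).comp ((F.pullback A W).incl z))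
    fun v => (F.pullback A W).incl_mem z v

end Pullback

section LeafwiseForms

/-- The restriction of a leafwise 1-form `θ` to the plaque through `x` of the foliated chart chosen
at `x`, as a differential form in the coordinates `u ∈ P` of that plaque. -/
def plaqueForm (θ : ∀ x : M, F.Tangent x →L[ℝ] ℝ) (x : M) (u : P) : P →L[ℝ] ℝ :=
  (θ ((F.chart x).symm (u, (F.chart x x).2))).comp
    (F.leafFrame x ((F.chart x).symm (u, (F.chart x x).2)))

/-- The leafwise exterior derivative `d_F θ` of a leafwise 1-form `θ`: at `x`, it is the exterior
derivative of the restriction of `θ` to the leaf through `x`. -/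
def leafwiseExtDeriv (θ : ∀ x : M, F.Tangent x →L[ℝ] ℝ) (x : M) :
    F.Tangent x [⋀^Fin 2]→L[ℝ] ℝ :=
  (extDeriv (fun u : P => ContinuousAlternatingMap.ofSubsingleton ℝ P ℝ (0 : Fin 1)
    (F.plaqueForm θ x u)) (F.chart x x).1).compContinuousLinearMap (F.leafCoord x x)

/-- The field of subspaces of `TM ⊕ T*M` with characteristic foliation `F` and with the leafwise
2-form `Ω` as presymplectic forms on the leaves: it consists of the `(X, α)` with `X` tangent to the
leaf and `α(Y) = Ω(X, Y)` for all `Y` tangent to the leaf. -/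
def diracOfForm (Ω : ∀ x : M, F.Tangent x [⋀^Fin 2]→L[ℝ] ℝ) (x : M) :
    Submodule ℝ (TangentSpace I x × (TangentSpace I x →L[ℝ] ℝ)) where
  carrier := {p | ∃ X : F.Tangent x, F.incl x X = p.1 ∧
    ∀ Y : F.Tangent x, p.2 (F.incl x Y) = Ω x ![X, Y]}
  zero_mem' := ⟨0, map_zero _, fun Y => by
    simpa using ((Ω x).map_coord_zero (m := ![0, Y]) 0 rfl).symm⟩
  add_mem' := by
    rintro ⟨X, α⟩ ⟨X', α'⟩ ⟨U, rfl, hα⟩ ⟨U', rfl, hα'⟩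
    refine ⟨U + U', map_add _ _ _, fun Y => ?_⟩
    have h := (Ω x).toAlternatingMap.map_vecCons_add ![Y] U U'
    change α (F.incl x Y) + α' (F.incl x Y) = _
    rw [hα, hα']
    exact h.symm
  smul_mem' := by
    rintro c ⟨X, α⟩ ⟨U, rfl, hα⟩
    refine ⟨c • U, map_smul _ _ _, fun Y => ?_⟩
    have h := (Ω x).toAlternatingMap.map_vecCons_smul ![Y] c U
    change c • α (F.incl x Y) = _
    rw [hα]
    exact h.symm

end LeafwiseForms

section Canonical

variable [IsManifold I ∞ M]

/-- The foliation of the total space of `T*F` by the cotangent bundles `T*N` of the leaves `N`. -/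
abbrev cotangentFoliation :
    RegularFoliation (I.prod 𝓘(ℝ, P →L[ℝ] ℝ)) (P × (P →L[ℝ] ℝ)) Q
      (TotalSpace (P →L[ℝ] ℝ) F.Cotangent) :=
  F.pullback (P →L[ℝ] ℝ) F.Cotangent

/-- The Liouville 1-form on the leaves `T*N` of `T*F`: at a covector `ξ` it is `X ↦ ξ(dπ X)`. -/
def liouvilleForm (z : TotalSpace (P →L[ℝ] ℝ) F.Cotangent) :
    F.cotangentFoliation.Tangent z →L[ℝ] ℝ :=
  z.2.comp (F.tangentProj (P →L[ℝ] ℝ) F.Cotangent z)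

/-- The standard symplectic form on the leaves `T*N` of `T*F`: the exterior derivative of the
Liouville form, that is, `∑ dpᵢ ∧ dqᵢ` in canonical coordinates. -/
def symplecticForm (z : TotalSpace (P →L[ℝ] ℝ) F.Cotangent) :
    F.cotangentFoliation.Tangent z [⋀^Fin 2]→L[ℝ] ℝ :=
  F.cotangentFoliation.leafwiseExtDeriv F.liouvilleForm z

variable (B : Type*) [NormedAddCommGroup B] [NormedSpace ℝ B] (V : M → Type*)
  [TopologicalSpace (TotalSpace B V)] [∀ x, AddCommGroup (V x)] [∀ x, Module ℝ (V x)]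
  [∀ x, TopologicalSpace (V x)] [FiberBundle B V] [VectorBundle ℝ B V]
  [ContMDiffVectorBundle ∞ B V I]

/-- The projection `T*F ⊕ V → T*F`. -/
def fstProj (z : TotalSpace ((P →L[ℝ] ℝ) × B) (F.Cotangent ×ᵇ V)) :
    TotalSpace (P →L[ℝ] ℝ) F.Cotangent := ⟨z.1, z.2.1⟩

lemma contMDiff_fstProj : ContMDiff (I.prod 𝓘(ℝ, (P →L[ℝ] ℝ) × B)) (I.prod 𝓘(ℝ, P →L[ℝ] ℝ)) ∞
    (F.fstProj B V) := by
  intro z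
  rw [contMDiffAt_totalSpace]
  have h : ContMDiffAt (I.prod 𝓘(ℝ, (P →L[ℝ] ℝ) × B)) (I.prod 𝓘(ℝ, (P →L[ℝ] ℝ) × B)) ∞
    (id : TotalSpace ((P →L[ℝ] ℝ) × B) (F.Cotangent ×ᵇ V) → _) z := contMDiffAt_id
  rw [contMDiffAt_totalSpace] at h
  refine ⟨h.1, ?_⟩
  exact contDiff_fst.contMDiff.contMDiffAt.comp z h.2

/-- The foliation of the total space of `T*F ⊕ V` by the preimages of the leaves of `F`. -/
abbrev characteristicFoliation :
    RegularFoliation (I.prod 𝓘(ℝ, (P →L[ℝ] ℝ) × B)) (P × ((P →L[ℝ] ℝ) × B)) Q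
      (TotalSpace ((P →L[ℝ] ℝ) × B) (F.Cotangent ×ᵇ V)) :=
  F.pullback ((P →L[ℝ] ℝ) × B) (F.Cotangent ×ᵇ V)

lemma mfderiv_fstProj_mem (z : TotalSpace ((P →L[ℝ] ℝ) × B) (F.Cotangent ×ᵇ V))
    (v : (F.characteristicFoliation B V).Tangent z) :
    mfderiv (I.prod 𝓘(ℝ, (P →L[ℝ] ℝ) × B)) (I.prod 𝓘(ℝ, P →L[ℝ] ℝ)) (F.fstProj B V) z
      ((F.characteristicFoliation B V).incl z v) ∈ F.cotangentFoliation.tangent (F.fstProj B V z) := by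
  have h := mfderiv_comp z (I'' := I)
    ((contMDiffAt_proj (n := ∞) (IB := I) (F.Cotangent)
      (p := F.fstProj B V z)).mdifferentiableAt (by simp))
    ((F.contMDiff_fstProj B V z).mdifferentiableAt (by simp))
  have hv := (F.characteristicFoliation B V).incl_mem z v
  change mfderiv (I.prod 𝓘(ℝ, (P →L[ℝ] ℝ) × B)) I
    (π (P →L[ℝ] ℝ) F.Cotangent ∘ F.fstProj B V) z ((F.characteristicFoliation B V).incl z v) ∈
      F.tangent z.1 at hv
  rw [h] at hv
  exact hv

/-- The pull-back of the standard symplectic forms of the `T*N` to the leaves of the foliation of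
`T*F ⊕ V`, under the projection `T*F ⊕ V → T*F`. -/
def presymplecticForm (z : TotalSpace ((P →L[ℝ] ℝ) × B) (F.Cotangent ×ᵇ V)) :
    (F.characteristicFoliation B V).Tangent z [⋀^Fin 2]→L[ℝ] ℝ :=
  (F.symplecticForm (F.fstProj B V z)).compContinuousLinearMap
    (F.cotangentFoliation.restrict
      ((mfderiv (I.prod 𝓘(ℝ, (P →L[ℝ] ℝ) × B)) (I.prod 𝓘(ℝ, P →L[ℝ] ℝ)) (F.fstProj B V) z).comp
        ((F.characteristicFoliation B V).incl z))
      (F.mfderiv_fstProj_mem B V z))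

/-- The canonical Dirac structure on the total space of `T*F ⊕ V`: its characteristic leaves are the
preimages of the leaves `N` of `F`, with the pull-back of the standard symplectic form of `T*N`. -/
def canonicalDirac (z : TotalSpace ((P →L[ℝ] ℝ) × B) (F.Cotangent ×ᵇ V)) :
    Submodule ℝ (TangentSpace (I.prod 𝓘(ℝ, (P →L[ℝ] ℝ) × B)) z ×
      (TangentSpace (I.prod 𝓘(ℝ, (P →L[ℝ] ℝ) × B)) z →L[ℝ] ℝ)) :=
  (F.characteristicFoliation B V).diracOfForm (F.presymplecticForm B V) z

end Canonical

end RegularFoliation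

section Dirac

variable {E : Type*} [NormedAddCommGroup E] [NormedSpace ℝ E]
  {H : Type*} [TopologicalSpace H] (I : ModelWithCorners ℝ E H)
  {M : Type*} [TopologicalSpace M] [ChartedSpace H M]

/-- The characteristic space `proj_{TM} D(x)` of a field `D` of subspaces of `TM ⊕ T*M`. -/
def characteristicSpace
    (D : ∀ x : M, Submodule ℝ (TangentSpace I x × (TangentSpace I x →L[ℝ] ℝ))) (x : M) :
    Submodule ℝ (TangentSpace I x) :=
  (D x).map (LinearMap.fst ℝ (TangentSpace I x) (TangentSpace I x →L[ℝ] ℝ))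

/-- The kernel space `D(x) ∩ T_xM` of a field `D` of subspaces of `TM ⊕ T*M`. -/
def kernelSpace
    (D : ∀ x : M, Submodule ℝ (TangentSpace I x × (TangentSpace I x →L[ℝ] ℝ))) (x : M) :
    Submodule ℝ (TangentSpace I x) :=
  (D x).comap (LinearMap.inl ℝ (TangentSpace I x) (TangentSpace I x →L[ℝ] ℝ))

/-- The pointwise conditions on a regular Dirac structure `D ⊂ TM ⊕ T*M` of bi-corank `(r, s)`:
`D` is isotropic for the natural symmetric pairing and of rank `dim M`, the spaces `D(x) ∩ T_xM`
have dimension `r`, and the spaces `D(x) ∩ T*_xM` have dimension `s`. -/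
structure IsRegularOfBicorank
    (D : ∀ x : M, Submodule ℝ (TangentSpace I x × (TangentSpace I x →L[ℝ] ℝ))) (r s : ℕ) :
    Prop where
  isotropic : ∀ x, ∀ p ∈ D x, ∀ q ∈ D x, (1 / 2 : ℝ) * (p.2 q.1 + q.2 p.1) = 0
  finrank_eq : ∀ x, Module.finrank ℝ (D x) = Module.finrank ℝ E
  finrank_inter_tangent : ∀ x, Module.finrank ℝ (kernelSpace I D x) = r
  finrank_inter_cotangent : ∀ x, Module.finrank ℝ
    ((D x).comap (LinearMap.inr ℝ (TangentSpace I x) (TangentSpace I x →L[ℝ] ℝ))) = s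

variable {E' : Type*} [NormedAddCommGroup E'] [NormedSpace ℝ E']
  {H' : Type*} [TopologicalSpace H'] (J : ModelWithCorners ℝ E' H')
  {N : Type*} [TopologicalSpace N] [ChartedSpace H' N]

/-- The submanifold of `M` parametrized by `f : N → M` is co-Lagrangian for `D`, of bi-corank
`(r, s)`: it is an embedded submanifold of dimension `(dim M - r + s) / 2`, and at each of its
points `x = f y`, with tangent space `T = range (df_y)`,
a) `T + proj_{TM} D(x) = T_xM`;
b) `T ∩ (T_xM ∩ D(x)) = 0`;
c) the presymplectic form of the characteristic leaf through `x`, which is `ω(X, Y) = ⟨α, Y⟩` for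
`(X, α) ∈ D(x)` and `Y ∈ proj_{TM} D(x)`, vanishes on the vectors `X`, `Y` of `T` that are tangent
to that leaf. -/
structure IsCoLagrangianOfBicorank
    (D : ∀ x : M, Submodule ℝ (TangentSpace I x × (TangentSpace I x →L[ℝ] ℝ)))
    (f : N → M) (r s : ℕ) : Prop where
  isRegular : IsRegularOfBicorank I D r s
  isSmoothEmbedding : Manifold.IsSmoothEmbedding J I ∞ f
  dim_eq : (Module.finrank ℝ E' : ℝ) = (1 / 2) * (Module.finrank ℝ E - r + s)
  sup_eq_top : ∀ y, (mfderiv J I f y).range ⊔ characteristicSpace I D (f y) = ⊤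
  inf_eq_bot : ∀ y, (mfderiv J I f y).range ⊓ kernelSpace I D (f y) = ⊥
  isotropic : ∀ y, ∀ X ∈ (mfderiv J I f y).range, ∀ Y ∈ (mfderiv J I f y).range,
    Y ∈ characteristicSpace I D (f y) →
      ∀ α : TangentSpace I (f y) →L[ℝ] ℝ, (X, α) ∈ D (f y) → α Y = 0

/-- The submanifold of `M` parametrized by `f : N → M` is co-Lagrangian for `D`. -/
def IsCoLagrangian
    (D : ∀ x : M, Submodule ℝ (TangentSpace I x × (TangentSpace I x →L[ℝ] ℝ)))
    (f : N → M) : Prop :=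
  ∃ r s : ℕ, IsCoLagrangianOfBicorank I J D f r s

end Dirac

end

/-! The standard symplectic form on the leaves is the exterior derivative of the Liouville form `λ`,
and `λ` is tautological: pulled back by a leafwise 1-form `θ` it gives `θ` back. Hence a section `K
= (θ, v)`, restricted to a leaf `N`, pulls `ω_S` back to `d_F θ`; the component `v` does not matter,
because `ω_S` comes from `T*N`. The tangent vectors of `K` that lie along `S` are exactly the
`dK(ξ)` with `ξ` tangent to `N`, so condition (c) says precisely `d_F θ = 0`
(`section_isotropic_iff`).

All other requirements hold for every smooth section. Since `dπ ∘ dK = id`, each tangent vector of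
the total space is a vector of `T K` plus a vertical one, and vertical vectors are tangent to the
leaves `π⁻¹(N)`: this is (a). The kernel of `ω_S` consists of the directions of the fibers of `V`,
which are vertical, and `T K` contains no nonzero vertical vector: this is (b). The bi-corank is
`(rank V, codim F)`, which makes the dimension condition an identity.

The pull-back is computed in coordinates. A foliated chart of `L` and a trivialization of the bundle
give coordinates `(q, p, b)` along the leaves of the total space, where `ω_S(X, Y) = p_X(q_Y) -
p_Y(q_X)` (`presymplecticForm_apply`). By `leafCoord_section`, `dK(ξ)` has as `q`-part the
coordinates of `ξ` and as `p`-part the derivative along `ξ` of the local expression of `θ`.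
Substituting these gives the coordinate formula for `d_F θ` (`presymplecticForm_section`). -/

noncomputable section

namespace RegularFoliation

/-! ### Linear algebra of the Dirac structure defined by a leafwise 2-form -/

section LinearAlgebra

variable {E : Type*} [NormedAddCommGroup E] [NormedSpace ℝ E]
  {H : Type*} [TopologicalSpace H] {I : ModelWithCorners ℝ E H}
  {P Q : Type*} [NormedAddCommGroup P] [NormedSpace ℝ P]
  [NormedAddCommGroup Q] [NormedSpace ℝ Q]
  {M : Type*} [TopologicalSpace M] [ChartedSpace H M]
  (F : RegularFoliation I P Q M)

/-- The derivative of a foliated chart, as an isomorphism. -/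
def chartDerivEquiv {x y : M} (hy : y ∈ (F.chart x).source) : TangentSpace I y ≃L[ℝ] P × Q :=
  ContinuousLinearEquiv.equivOfInverse (F.chartDeriv x y) (F.chartDerivSymm x y)
    (F.chartDerivSymm_chartDeriv hy) (F.chartDeriv_chartDerivSymm hy)

/-- The leaf coordinates of a foliated chart, as an isomorphism. -/
def leafCoordEquiv {x y : M} (hy : y ∈ (F.chart x).source) : F.Tangent y ≃L[ℝ] P :=
  ContinuousLinearEquiv.equivOfInverse (F.leafCoord x y) (F.leafFrame x y)
    (F.leafFrame_leafCoord hy) (F.leafCoord_leafFrame hy)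

lemma leafCoord_injective {x y : M} (hy : y ∈ (F.chart x).source) :
    Function.Injective (F.leafCoord x y) := (F.leafCoordEquiv hy).injective

lemma finrank_tangent (x : M) : Module.finrank ℝ (F.tangent x) = Module.finrank ℝ P :=
  (F.leafCoordEquiv (F.mem_chart_source x)).toLinearEquiv.finrank_eq

/-- The point `x` is essential: over an empty manifold nothing relates `E` to `P × Q`. The main
theorem therefore treats the empty base separately. -/
lemma finrank_model_eq (F : RegularFoliation I P Q M) [FiniteDimensional ℝ P]
    [FiniteDimensional ℝ Q] (x : M) :
    Module.finrank ℝ E = Module.finrank ℝ P + Module.finrank ℝ Q := by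
  rw [← Module.finrank_prod]
  exact (F.chartDerivEquiv (F.mem_chart_source x)).toLinearEquiv.finrank_eq

instance [FiniteDimensional ℝ E] (x : M) : FiniteDimensional ℝ (TangentSpace I x) :=
  inferInstanceAs (FiniteDimensional ℝ E)

instance (x : M) : T2Space (TangentSpace I x) := inferInstanceAs (T2Space E)

variable (Ω : ∀ x : M, F.Tangent x [⋀^Fin 2]→L[ℝ] ℝ)

lemma mem_diracOfForm {x : M} (p : TangentSpace I x × (TangentSpace I x →L[ℝ] ℝ)) :
    p ∈ F.diracOfForm Ω x ↔ ∃ X : F.Tangent x, F.incl x X = p.1 ∧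
      ∀ Y : F.Tangent x, p.2 (F.incl x Y) = Ω x ![X, Y] := Iff.rfl

lemma mem_diracOfForm_incl {x : M} (X : F.Tangent x) (α : TangentSpace I x →L[ℝ] ℝ) :
    (F.incl x X, α) ∈ F.diracOfForm Ω x ↔
      ∀ Y : F.Tangent x, α (F.incl x Y) = Ω x ![X, Y] := by
  rw [mem_diracOfForm]
  constructor
  · rintro ⟨X', h, h'⟩
    obtain rfl := F.incl_injective x h
    exact h'
  · exact fun h => ⟨X, rfl, h⟩

/-- The functional `Ω(X, ·)` on the leaf tangent space extends linearly to the whole tangent space,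
and the extension is continuous because the dimension is finite. Thus every leaf direction occurs in
the projection of the Dirac structure. -/
lemma exists_mem_diracOfForm [FiniteDimensional ℝ E] {x : M} (X : F.Tangent x) :
    ∃ α : TangentSpace I x →L[ℝ] ℝ, (F.incl x X, α) ∈ F.diracOfForm Ω x := by
  obtain ⟨α, hα⟩ := LinearMap.exists_extend (p := F.tangent x)
    ((Ω x).toContinuousMultilinearMap.toContinuousLinearMap ![X, 0] 1).toLinearMap
  refine ⟨LinearMap.toContinuousLinearMap (E := TangentSpace I x) α,
    (F.mem_diracOfForm_incl Ω X _).2 fun Y => ?_⟩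
  have h := DFunLike.congr_fun hα Y
  have h2 : Function.update ![X, 0] 1 Y = ![X, Y] := by
    ext i; fin_cases i <;> rfl
  refine h.trans ?_
  change Ω x (Function.update ![X, 0] 1 Y) = _
  rw [h2]

lemma characteristicSpace_diracOfForm [FiniteDimensional ℝ E] (x : M) :
    characteristicSpace I (F.diracOfForm Ω) x = F.tangent x := by
  ext X
  constructor
  · rintro ⟨p, ⟨X', h, -⟩, rfl⟩
    rw [LinearMap.fst_apply, ← h]
    exact F.incl_mem x X'
  · intro hX
    obtain ⟨α, hα⟩ := F.exists_mem_diracOfForm Ω (x := x) ⟨X, hX⟩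
    exact ⟨_, hα, rfl⟩

lemma mem_kernelSpace_diracOfForm {x : M} (v : TangentSpace I x) :
    v ∈ kernelSpace I (F.diracOfForm Ω) x ↔
      ∃ X : F.Tangent x, F.incl x X = v ∧ ∀ Y, Ω x ![X, Y] = 0 :=
  exists_congr fun _ => and_congr_right fun _ => forall_congr' fun _ => eq_comm

lemma form_swap {x : M} (X Y : F.Tangent x) : Ω x ![X, Y] = -Ω x ![Y, X] := by
  have h := (Ω x).toAlternatingMap.map_swap ![Y, X] (i := 0) (j := 1) (by decide)
  rw [show ![Y, X] ∘ Equiv.swap (0 : Fin 2) 1 = ![X, Y] by ext i; fin_cases i <;> rfl] at h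
  exact h

lemma diracOfForm_isotropic {x : M} (p q : TangentSpace I x × (TangentSpace I x →L[ℝ] ℝ))
    (hp : p ∈ F.diracOfForm Ω x) (hq : q ∈ F.diracOfForm Ω x) : p.2 q.1 + q.2 p.1 = 0 := by
  obtain ⟨X, hX, hX'⟩ := hp
  obtain ⟨Y, hY, hY'⟩ := hq
  rw [← hX, ← hY, hX', hY', F.form_swap Ω X Y, neg_add_cancel]

/-- The functionals on `T_xM` that vanish on the leaf tangent space form a space of dimension
the codimension of the foliation. -/
lemma finrank_diracOfForm_inter_cotangent [FiniteDimensional ℝ E] [FiniteDimensional ℝ P]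
    [FiniteDimensional ℝ Q] (x : M) :
    Module.finrank ℝ ((F.diracOfForm Ω x).comap
      (LinearMap.inr ℝ (TangentSpace I x) (TangentSpace I x →L[ℝ] ℝ))) = Module.finrank ℝ Q := by
  have h := Subspace.finrank_add_finrank_dualAnnihilator_eq (F.tangent x)
  -- A pair `(0, α)` lies in the structure exactly when `α` kills the leaf directions, since `Ω(0,
  -- ·) = 0`; these `α` form the annihilator of the leaf tangent space.
  have h2 : (F.diracOfForm Ω x).comap
      (LinearMap.inr ℝ (TangentSpace I x) (TangentSpace I x →L[ℝ] ℝ)) =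
      (F.tangent x).dualAnnihilator.map
        (LinearMap.toContinuousLinearMap (E := TangentSpace I x) (F' := ℝ) (𝕜 := ℝ)).toLinearMap := by
    ext α
    rw [Submodule.mem_comap, LinearMap.inr_apply, ← map_zero (F.incl x), mem_diracOfForm_incl]
    have h0 : ∀ Y, Ω x ![0, Y] = 0 := fun Y => (Ω x).map_coord_zero 0 rfl
    simp only [h0]
    constructor
    · intro hα
      refine ⟨α.toLinearMap, (Submodule.mem_dualAnnihilator _).2 fun w hw => hα ⟨w, hw⟩, ?_⟩
      ext; rfl
    · rintro ⟨β, hβ, rfl⟩ Y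
      exact (Submodule.mem_dualAnnihilator _).1 hβ _ (F.incl_mem x Y)
  rw [h2, LinearEquiv.finrank_map_eq]
  have h3 : Module.finrank ℝ (TangentSpace I x) = Module.finrank ℝ E := rfl
  rw [h3, F.finrank_model_eq x, F.finrank_tangent] at h
  exact Nat.add_left_cancel h

/-- Rank-nullity for the projection to `TM`: the image is the leaf tangent space, the kernel is its
annihilator, and their dimensions add up to `dim M`. -/
lemma finrank_diracOfForm [FiniteDimensional ℝ E] [FiniteDimensional ℝ P]
    [FiniteDimensional ℝ Q] (x : M) :
    Module.finrank ℝ (F.diracOfForm Ω x) = Module.finrank ℝ E := by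
  set D := F.diracOfForm Ω x
  have h := LinearMap.finrank_range_add_finrank_ker (K := ℝ) (V := D) (V₂ := TangentSpace I x)
    ((LinearMap.fst ℝ (TangentSpace I x) (TangentSpace I x →L[ℝ] ℝ)).comp D.subtype)
  have h1 : ((LinearMap.fst ℝ (TangentSpace I x) (TangentSpace I x →L[ℝ] ℝ)).comp
    D.subtype).range = F.tangent x := by
    rw [LinearMap.range_comp, Submodule.range_subtype]
    exact F.characteristicSpace_diracOfForm Ω x
  have h2 : Module.finrank ℝ ((LinearMap.fst ℝ (TangentSpace I x) (TangentSpace I x →L[ℝ] ℝ)).comp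
    D.subtype).ker = Module.finrank ℝ Q := by
    rw [← F.finrank_diracOfForm_inter_cotangent Ω x]
    symm
    -- The isomorphism is `α ↦ (0, α)`.
    refine LinearEquiv.finrank_eq (LinearEquiv.ofBijective
      (LinearMap.codRestrict _ ((LinearMap.inr ℝ (TangentSpace I x)
        (TangentSpace I x →L[ℝ] ℝ)).restrict (p := D.comap _) (q := D) fun _ h => h)
        fun c => ?_) ⟨?_, ?_⟩)
    · rfl
    · intro a b hab
      exact Subtype.ext (congrArg (fun z => z.1.1.2) hab)
    · rintro ⟨⟨⟨X, α⟩, hz⟩, hX⟩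
      obtain rfl : X = 0 := hX
      exact ⟨⟨α, hz⟩, rfl⟩
  rw [h1, h2, F.finrank_tangent, ← F.finrank_model_eq x] at h
  exact h.symm

end LinearAlgebra

end RegularFoliation

namespace RegularFoliation

/-! ### Canonical coordinates on the leaves and the standard symplectic form -/

section Coordinates

variable {E : Type*} [NormedAddCommGroup E] [NormedSpace ℝ E]
  {H : Type*} [TopologicalSpace H] {I : ModelWithCorners ℝ E H}
  {P Q : Type*} [NormedAddCommGroup P] [NormedSpace ℝ P]
  [NormedAddCommGroup Q] [NormedSpace ℝ Q]
  {M : Type*} [TopologicalSpace M] [ChartedSpace H M]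
  (F : RegularFoliation I P Q M)

lemma symmL_trivializationAt_tangent {x y : M} (hy : y ∈ (F.chart x).source) (a : P) :
    (trivializationAt P F.Tangent x).symmL ℝ y a = F.leafFrame x y a := by
  have hy' : y ∈ (trivializationAt P F.Tangent x).baseSet := hy
  rw [← (trivializationAt P F.Tangent x).symmL_continuousLinearMapAt (R := ℝ) hy'
    (F.leafFrame x y a), Trivialization.continuousLinearMapAt_apply,
    Trivialization.coe_linearMapAt_of_mem _ hy']
  congr 1
  exact (F.leafCoord_leafFrame hy a).symm

/-- A hom bundle is trivialized by composing with the trivializations of its source and target; that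
of the trivial line bundle is the identity, so only the leaf frame remains. These are the momentum
coordinates `p`. -/
lemma trivializationAt_cotangent_apply {x : M} {z : TotalSpace (P →L[ℝ] ℝ) F.Cotangent}
    (hz : z.1 ∈ (F.chart x).source) (a : P) :
    (trivializationAt (P →L[ℝ] ℝ) F.Cotangent x z).2 a = z.2 (F.leafFrame x z.1 a) := by
  rw [hom_trivializationAt_apply]
  change (trivializationAt ℝ (Bundle.Trivial M ℝ) x).continuousLinearMapAt ℝ z.1
    (z.2 ((trivializationAt P F.Tangent x).symmL ℝ z.1 a)) = _
  rw [F.symmL_trivializationAt_tangent hz, Trivialization.continuousLinearMapAt_apply,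
    Trivialization.coe_linearMapAt_of_mem _ (mem_univ _)]
  rfl

section Pullback

variable (A : Type*) [NormedAddCommGroup A] [NormedSpace ℝ A] (W : M → Type*)
  [TopologicalSpace (TotalSpace A W)] [∀ x, AddCommGroup (W x)] [∀ x, Module ℝ (W x)]
  [∀ x, TopologicalSpace (W x)] [FiberBundle A W] [VectorBundle ℝ A W]
  [ContMDiffVectorBundle ∞ A W I]

/-- Near `z'` the `P`-component of the lifted chart is that of the base chart composed with `π`; the
chain rule and uniqueness of derivatives conclude. -/
lemma leafCoord_pullback_fst {z z' : TotalSpace A W} (hz : z' ∈ (F.liftChart A W z.1).source)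
    (X : (F.pullback A W).Tangent z') :
    ((F.pullback A W).leafCoord z z' X).1 = F.leafCoord z.1 z'.1 (F.tangentProj A W z' X) := by
  have hs := ((F.mem_liftChart_source A W _ z').1 hz).2
  have hnhds : (F.liftChart A W z.1).source ∈ 𝓝 z' :=
    (F.liftChart A W z.1).open_source.mem_nhds hz
  have hd : MDifferentiableAt (I.prod 𝓘(ℝ, A)) 𝓘(ℝ, (P × A) × Q) (F.liftChart A W z.1) z' :=
    ((F.contMDiffOn_liftChart A W z.1).contMDiffAt hnhds).mdifferentiableAt (by simp)
  have hp : MDifferentiableAt (I.prod 𝓘(ℝ, A)) I (π A W) z' :=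
    (contMDiffAt_proj (n := ∞) W).mdifferentiableAt (by simp)
  have hc := (F.mdifferentiable_chart z.1).mdifferentiableAt hs
  have e1 := ((ContinuousLinearMap.fst ℝ P A).comp
    (ContinuousLinearMap.fst ℝ (P × A) Q)).hasMFDerivAt.comp z' hd.hasMFDerivAt
  have e2 := (ContinuousLinearMap.fst ℝ P Q).hasMFDerivAt.comp z'
    (hc.hasMFDerivAt.comp z' hp.hasMFDerivAt)
  have e3 := e2.congr_of_eventuallyEq (f₁ := ((ContinuousLinearMap.fst ℝ P A).comp
    (ContinuousLinearMap.fst ℝ (P × A) Q)) ∘ F.liftChart A W z.1) (by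
      filter_upwards [hnhds] with w hw
      simp only [Function.comp_apply]
      rw [F.liftChart_apply A W z.1 w ((F.mem_liftChart_source A W _ w).1 hw).1]
      rfl)
  exact DFunLike.congr_fun (hasMFDerivAt_unique e1 e3) ((F.pullback A W).incl z' X)

lemma leafCoord_pullback_snd {z z' : TotalSpace A W} (hz : z' ∈ (F.liftChart A W z.1).source)
    (X : (F.pullback A W).Tangent z') :
    ((F.pullback A W).leafCoord z z' X).2 = mfderiv (I.prod 𝓘(ℝ, A)) 𝓘(ℝ, A)
      (fun w => (trivializationAt A W z.1 w).2) z' ((F.pullback A W).incl z' X) := by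
  have hnhds : (F.liftChart A W z.1).source ∈ 𝓝 z' :=
    (F.liftChart A W z.1).open_source.mem_nhds hz
  have hd : MDifferentiableAt (I.prod 𝓘(ℝ, A)) 𝓘(ℝ, (P × A) × Q) (F.liftChart A W z.1) z' :=
    ((F.contMDiffOn_liftChart A W z.1).contMDiffAt hnhds).mdifferentiableAt (by simp)
  have e1 := ((ContinuousLinearMap.snd ℝ P A).comp
    (ContinuousLinearMap.fst ℝ (P × A) Q)).hasMFDerivAt.comp z' hd.hasMFDerivAt
  have e3 := e1.congr_of_eventuallyEq (f₁ := fun w => (trivializationAt A W z.1 w).2) (by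
      filter_upwards [hnhds] with w hw
      simp only [Function.comp_apply]
      rw [F.liftChart_apply A W z.1 w ((F.mem_liftChart_source A W _ w).1 hw).1]
      rfl)
  rw [e3.mfderiv]
  rfl

/-- This evaluates the Liouville form on a coordinate frame, since that form sees a vector only
through its projection to the base. -/
lemma tangentProj_leafFrame {z z' : TotalSpace A W} (hz : z' ∈ (F.liftChart A W z.1).source)
    (w : P × A) :
    F.tangentProj A W z' ((F.pullback A W).leafFrame z z' w) = F.leafFrame z.1 z'.1 w.1 := by
  have hs := ((F.mem_liftChart_source A W _ z').1 hz).2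
  apply F.leafCoord_injective hs
  rw [F.leafCoord_leafFrame hs, ← F.leafCoord_pullback_fst A W hz,
    (F.pullback A W).leafCoord_leafFrame hz]

end Pullback

/-- The exterior derivative of a 1-form, on two vectors. -/
lemma extDeriv_ofSubsingleton {θ : P → P →L[ℝ] ℝ} {u : P} (hθ : DifferentiableAt ℝ θ u)
    (X Y : P) :
    extDeriv (fun u => ContinuousAlternatingMap.ofSubsingleton ℝ P ℝ (0 : Fin 1) (θ u)) u ![X, Y] =
      fderiv ℝ θ u X Y - fderiv ℝ θ u Y X := by
  have hd : DifferentiableAt ℝ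
      (fun u => ContinuousAlternatingMap.ofSubsingleton ℝ P ℝ (0 : Fin 1) (θ u)) u :=
    ((ContinuousAlternatingMap.ofSubsingletonLIE (𝕜 := ℝ) (E := P) (F := ℝ)
      (0 : Fin 1)).toContinuousLinearEquiv.differentiableAt).comp u hθ
  -- In the alternating sum, removing index `0` leaves `Y`, differentiated along `X`; removing index
  -- `1` leaves `X`, differentiated along `Y`, with sign `-1`.
  rw [extDeriv_apply hd, Fin.sum_univ_two]
  have h : ∀ (i : Fin 2) (v : Fin 2 → P), (fun u => ContinuousAlternatingMap.ofSubsingleton ℝ P ℝ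
      (0 : Fin 1) (θ u) (i.removeNth v)) = fun u => θ u (i.removeNth v 0) := fun _ _ => rfl
  rw [h, h]
  have h2 : ∀ c d : P, fderiv ℝ (fun u => θ u c) u d = fderiv ℝ θ u d c := fun c d => by
    have := (hθ.hasFDerivAt.clm_apply (hasFDerivAt_const c u)).fderiv
    rw [this]; simp
  rw [h2, h2]
  simp [Fin.removeNth, sub_eq_add_neg]

lemma leafwiseExtDeriv_apply {θ : ∀ x : M, F.Tangent x →L[ℝ] ℝ} {x : M}
    (hθ : DifferentiableAt ℝ (F.plaqueForm θ x) (F.chart x x).1) (X Y : F.Tangent x) :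
    F.leafwiseExtDeriv θ x ![X, Y] =
      fderiv ℝ (F.plaqueForm θ x) (F.chart x x).1 (F.leafCoord x x X) (F.leafCoord x x Y) -
      fderiv ℝ (F.plaqueForm θ x) (F.chart x x).1 (F.leafCoord x x Y) (F.leafCoord x x X) := by
  rw [← extDeriv_ofSubsingleton hθ]
  rw [leafwiseExtDeriv, ContinuousAlternatingMap.compContinuousLinearMap_apply]
  congr 1
  ext i; fin_cases i <;> rfl

/-- In the coordinates of a foliated chart the Liouville form is `∑ pᵢ dqᵢ`. -/
lemma plaqueForm_liouvilleForm {z : TotalSpace (P →L[ℝ] ℝ) F.Cotangent}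
    {w : P × (P →L[ℝ] ℝ)}
    (hw : (w, (F.cotangentFoliation.chart z z).2) ∈ (F.cotangentFoliation.chart z).target) :
    F.cotangentFoliation.plaqueForm F.liouvilleForm z w =
      w.2.comp (ContinuousLinearMap.fst ℝ P (P →L[ℝ] ℝ)) := by
  set q := (F.cotangentFoliation.chart z z).2
  set z' := (F.cotangentFoliation.chart z).symm (w, q) with hz'
  have hs : z' ∈ (F.liftChart (P →L[ℝ] ℝ) F.Cotangent z.1).source :=
    (F.cotangentFoliation.chart z).map_target hw
  have hb := (F.mem_liftChart_source _ _ _ z').1 hs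
  refine ContinuousLinearMap.ext fun c => ?_
  change z'.2 (F.tangentProj _ _ z' (F.cotangentFoliation.leafFrame z z' c)) = w.2 c.1
  rw [F.tangentProj_leafFrame _ _ hs, ← F.trivializationAt_cotangent_apply hb.2]
  -- The momentum coordinate of the point with coordinates `(w, q)` is `w.2`.
  have h1 : F.liftChart (P →L[ℝ] ℝ) F.Cotangent z.1 z' = (w, q) :=
    (F.cotangentFoliation.chart z).right_inv hw
  rw [F.liftChart_apply _ _ z.1 z' hb.1] at h1
  exact congrArg (fun w => w.1.2 c.1) h1

/-- The standard symplectic form in the coordinates of a foliated chart. -/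
lemma symplecticForm_apply [IsManifold I ∞ M] (z : TotalSpace (P →L[ℝ] ℝ) F.Cotangent)
    (X Y : F.cotangentFoliation.Tangent z) :
    F.symplecticForm z ![X, Y] =
      (F.cotangentFoliation.leafCoord z z X).2 (F.cotangentFoliation.leafCoord z z Y).1 -
      (F.cotangentFoliation.leafCoord z z Y).2 (F.cotangentFoliation.leafCoord z z X).1 := by
  set G := F.cotangentFoliation
  set w₀ := (G.chart z z).1
  have hmem : ∀ᶠ w in 𝓝 w₀, (w, (G.chart z z).2) ∈ (G.chart z).target :=
    (Continuous.prodMk_left _).continuousAt.eventually_mem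
      ((G.chart z).open_target.mem_nhds ((G.chart z).map_source (G.mem_chart_source z)))
  -- Near `w₀` the Liouville form is `(q, p) ↦ p ∘ fst`, a continuous linear function of the
  -- coordinates, hence its own derivative.
  have heq : G.plaqueForm F.liouvilleForm z =ᶠ[𝓝 w₀] fun w =>
      ((ContinuousLinearMap.compL ℝ (P × (P →L[ℝ] ℝ)) P ℝ).flip
        (ContinuousLinearMap.fst ℝ P (P →L[ℝ] ℝ))).comp
        (ContinuousLinearMap.snd ℝ P (P →L[ℝ] ℝ)) w :=
    hmem.mono fun w hw => F.plaqueForm_liouvilleForm hw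
  have hder := (ContinuousLinearMap.hasFDerivAt (x := w₀)
    (((ContinuousLinearMap.compL ℝ (P × (P →L[ℝ] ℝ)) P ℝ).flip
        (ContinuousLinearMap.fst ℝ P (P →L[ℝ] ℝ))).comp
        (ContinuousLinearMap.snd ℝ P (P →L[ℝ] ℝ)))).congr_of_eventuallyEq heq
  rw [symplecticForm, leafwiseExtDeriv_apply _ hder.differentiableAt, hder.fderiv]
  rfl

end Coordinates

end RegularFoliation

/-! ### Derivatives of sections of vector bundles -/

section MFDeriv

variable {E : Type*} [NormedAddCommGroup E] [NormedSpace ℝ E]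
  {H : Type*} [TopologicalSpace H] {I : ModelWithCorners ℝ E H}
  {M : Type*} [TopologicalSpace M] [ChartedSpace H M]
  {A B : Type*} [NormedAddCommGroup A] [NormedSpace ℝ A] [NormedAddCommGroup B] [NormedSpace ℝ B]

lemma mfderiv_fst_apply {g : M → A × B} {x : M} (hg : MDifferentiableAt I 𝓘(ℝ, A × B) g x)
    (v : TangentSpace I x) :
    (mfderiv I 𝓘(ℝ, A × B) g x v : A × B).1 = mfderiv I 𝓘(ℝ, A) (fun y => (g y).1) x v :=
  (DFunLike.congr_fun
    ((ContinuousLinearMap.fst ℝ A B).hasMFDerivAt.comp x hg.hasMFDerivAt).mfderiv v).symm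

section Section

variable (A)

lemma mfderiv_proj_section {W : M → Type*} [TopologicalSpace (TotalSpace A W)]
    [∀ x, AddCommGroup (W x)] [∀ x, TopologicalSpace (W x)] [FiberBundle A W] {s : ∀ x, W x}
    (hs : ContMDiff I (I.prod 𝓘(ℝ, A)) ∞ fun x => TotalSpace.mk' A x (s x)) (x : M) (ξ : TangentSpace I x) :
    mfderiv (I.prod 𝓘(ℝ, A)) I (π A W) (TotalSpace.mk' A x (s x))
      (mfderiv I (I.prod 𝓘(ℝ, A)) (fun x => TotalSpace.mk' A x (s x)) x ξ) = ξ := by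
  have hp : MDifferentiableAt (I.prod 𝓘(ℝ, A)) I (π A W) (TotalSpace.mk' A x (s x)) :=
    (contMDiffAt_proj (n := ∞) W).mdifferentiableAt (by simp)
  have h := mfderiv_comp x hp ((hs x).mdifferentiableAt (by simp))
  have h2 : π A W ∘ (fun x => TotalSpace.mk' A x (s x)) = id := rfl
  rw [h2, mfderiv_id] at h
  exact (DFunLike.congr_fun h ξ).symm

variable (W : M → Type*)
  [TopologicalSpace (TotalSpace A W)] [∀ x, AddCommGroup (W x)] [∀ x, Module ℝ (W x)]
  [∀ x, TopologicalSpace (W x)] [FiberBundle A W] [VectorBundle ℝ A W]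
  [ContMDiffVectorBundle ∞ A W I]

lemma mdifferentiableAt_trivializationAt_snd {x : M} {z : TotalSpace A W}
    (hz : z.1 ∈ (trivializationAt A W x).baseSet) :
    MDifferentiableAt (I.prod 𝓘(ℝ, A)) 𝓘(ℝ, A) (fun w => (trivializationAt A W x w).2) z := by
  have hz' : z ∈ (trivializationAt A W x).source := (Trivialization.mem_source _).2 hz
  have h : ContMDiffAt (I.prod 𝓘(ℝ, A)) (I.prod 𝓘(ℝ, A)) ∞ (trivializationAt A W x) z :=
    ((trivializationAt A W x).contMDiffOn (IB := I) (n := ∞)).contMDiffAt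
      ((trivializationAt A W x).open_source.mem_nhds hz')
  exact (contMDiffAt_snd.comp z h).mdifferentiableAt (by simp)

variable {W} {s : ∀ x, W x}

lemma mfderiv_trivialization_section
    (hs : ContMDiff I (I.prod 𝓘(ℝ, A)) ∞ fun x => TotalSpace.mk' A x (s x)) (x : M) (ξ : TangentSpace I x) :
    mfderiv (I.prod 𝓘(ℝ, A)) 𝓘(ℝ, A) (fun w => (trivializationAt A W x w).2)
      (TotalSpace.mk' A x (s x))
      (mfderiv I (I.prod 𝓘(ℝ, A)) (fun x => TotalSpace.mk' A x (s x)) x ξ) =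
      mfderiv I 𝓘(ℝ, A) (fun y => (trivializationAt A W x (TotalSpace.mk' A y (s y))).2) x ξ := by
  have hp := mdifferentiableAt_trivializationAt_snd (I := I) A W (x := x)
    (z := TotalSpace.mk' A x (s x)) (mem_baseSet_trivializationAt A W x)
  exact (DFunLike.congr_fun (mfderiv_comp x hp ((hs x).mdifferentiableAt (by simp))) ξ).symm

end Section

end MFDeriv

/-! ### Sections and leafwise forms in foliated coordinates -/

namespace RegularFoliation

variable {E : Type*} [NormedAddCommGroup E] [NormedSpace ℝ E]
  {H : Type*} [TopologicalSpace H] {I : ModelWithCorners ℝ E H}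
  {P Q : Type*} [NormedAddCommGroup P] [NormedSpace ℝ P]
  [NormedAddCommGroup Q] [NormedSpace ℝ Q]
  {M : Type*} [TopologicalSpace M] [ChartedSpace H M]
  (F : RegularFoliation I P Q M)

section Section

variable (A : Type*) [NormedAddCommGroup A] [NormedSpace ℝ A] {W : M → Type*}
  [TopologicalSpace (TotalSpace A W)] [∀ x, AddCommGroup (W x)] [∀ x, Module ℝ (W x)]
  [∀ x, TopologicalSpace (W x)] [FiberBundle A W] [VectorBundle ℝ A W]
  [ContMDiffVectorBundle ∞ A W I]
  {s : ∀ x, W x}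

lemma mfderiv_section_mem_iff
    (hs : ContMDiff I (I.prod 𝓘(ℝ, A)) ∞ fun x => TotalSpace.mk' A x (s x)) {x : M} (ξ : TangentSpace I x) :
    mfderiv I (I.prod 𝓘(ℝ, A)) (fun x => TotalSpace.mk' A x (s x)) x ξ ∈
      (F.pullback A W).tangent (TotalSpace.mk' A x (s x)) ↔ ξ ∈ F.tangent x := by
  change mfderiv (I.prod 𝓘(ℝ, A)) I (π A W) (TotalSpace.mk' A x (s x)) _ ∈ F.tangent x ↔ _
  rw [mfderiv_proj_section A hs]

/-- The first component comes from `π ∘ s = id`, the second from the chain rule for the fiber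
coordinate composed with `s`. For sections of `T*F ⊕ V` this supplies the values of `q` and `p` to
put into the presymplectic form. -/
lemma leafCoord_section
    (hs : ContMDiff I (I.prod 𝓘(ℝ, A)) ∞ fun x => TotalSpace.mk' A x (s x)) {x : M} (ξ : F.Tangent x)
    (X : (F.pullback A W).Tangent (TotalSpace.mk' A x (s x)))
    (hX : (F.pullback A W).incl _ X =
      mfderiv I (I.prod 𝓘(ℝ, A)) (fun x => TotalSpace.mk' A x (s x)) x (F.incl x ξ)) :
    (F.pullback A W).leafCoord (TotalSpace.mk' A x (s x)) _ X = (F.leafCoord x x ξ, mfderiv I 𝓘(ℝ, A)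
      (fun y => (trivializationAt A W x (TotalSpace.mk' A y (s y))).2) x (F.incl x ξ)) := by
  have hm := (F.pullback A W).mem_chart_source (TotalSpace.mk' A x (s x))
  refine Prod.ext ?_ ?_
  · rw [F.leafCoord_pullback_fst A W hm]
    congr 1
    apply F.incl_injective
    change mfderiv (I.prod 𝓘(ℝ, A)) I (π A W) (TotalSpace.mk' A x (s x))
      ((F.pullback A W).incl _ X) = _
    rw [hX, mfderiv_proj_section A hs]
  · rw [F.leafCoord_pullback_snd A W hm, hX]
    exact mfderiv_trivialization_section A hs x _

end Section

/-- The derivative of a smooth leafwise 1-form in the coordinates of a plaque. -/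
lemma exists_hasFDerivAt_plaqueForm {θ : ∀ x, F.Cotangent x}
    (hθ : ContMDiff I (I.prod 𝓘(ℝ, P →L[ℝ] ℝ)) ∞ fun x => TotalSpace.mk' (P →L[ℝ] ℝ) x (θ x))
    (x : M) : ∃ D : P →L[ℝ] P →L[ℝ] ℝ, HasFDerivAt (F.plaqueForm θ x) D (F.chart x x).1 ∧
      ∀ a, D a = mfderiv I 𝓘(ℝ, P →L[ℝ] ℝ) (fun y => (trivializationAt (P →L[ℝ] ℝ) F.Cotangent x
        (TotalSpace.mk' (P →L[ℝ] ℝ) y (θ y))).2) x (F.chartDerivSymm x x (a, 0)) := by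
  set g : M → (P →L[ℝ] ℝ) := fun y => (trivializationAt (P →L[ℝ] ℝ) F.Cotangent x
          (TotalSpace.mk' (P →L[ℝ] ℝ) y (θ y))).2
  have hx := F.mem_chart_source x
  have hg : MDifferentiableAt I 𝓘(ℝ, P →L[ℝ] ℝ) g x :=
    ((contMDiffAt_section x).1 (hθ x)).mdifferentiableAt (by simp)
  have hc : HasMFDerivAt 𝓘(ℝ, P × Q) I (F.chart x).symm (F.chart x x) (F.chartDerivSymm x x) :=
    ((F.mdifferentiable_chart x).mdifferentiableAt_symm
      ((F.chart x).map_source hx)).hasMFDerivAt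
  -- The chain rule needs the derivative at `(F.chart x).symm (F.chart x x)`, which equals `x` only
  -- by a rewrite.
  have hg' : HasMFDerivAt I 𝓘(ℝ, P →L[ℝ] ℝ) g ((F.chart x).symm (F.chart x x))
      (mfderiv I 𝓘(ℝ, P →L[ℝ] ℝ) g x) := by
    rw [(F.chart x).left_inv hx]; exact hg.hasMFDerivAt
  have h1 := (hg'.comp _ hc).hasFDerivAt
  have h2 : HasFDerivAt (fun u : P => (u, (F.chart x x).2)) (ContinuousLinearMap.inl ℝ P Q)
      (F.chart x x).1 := hasFDerivAt_prodMk_left _ _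
  have h3 := HasFDerivAt.comp (F.chart x x).1 (f := fun u : P => (u, (F.chart x x).2)) h1 h2
  refine ⟨_, h3.congr_of_eventuallyEq ?_, fun a => rfl⟩
  have hmem : ∀ᶠ u in 𝓝 (F.chart x x).1, (u, (F.chart x x).2) ∈ (F.chart x).target :=
    (Continuous.prodMk_left _).continuousAt.eventually_mem
      ((F.chart x).open_target.mem_nhds ((F.chart x).map_source hx))
  filter_upwards [hmem] with u hu
  refine ContinuousLinearMap.ext fun a => ?_
  -- The coefficient of `θ` on the plaque is `θ` evaluated on the leaf frame, which is the fiber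
  -- coordinate `g` along the plaque.
  exact (F.trivializationAt_cotangent_apply (z := TotalSpace.mk' (P →L[ℝ] ℝ) _
    (θ ((F.chart x).symm (u, (F.chart x x).2)))) ((F.chart x).map_target hu) a).symm

/-- The inverse chart derivative sends `(leafCoord ξ, 0)` back to `ξ`, so differentiating in plaque
coordinates is differentiating the fiber coordinate of `θ` along `ξ`. This matches `d_F θ` with the
`p`-part of the derivative of the section. -/
lemma fderiv_plaqueForm_leafCoord {θ : ∀ x, F.Cotangent x}
    (hθ : ContMDiff I (I.prod 𝓘(ℝ, P →L[ℝ] ℝ)) ∞ fun x => TotalSpace.mk' (P →L[ℝ] ℝ) x (θ x))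
    {x : M} (ξ : F.Tangent x) :
    fderiv ℝ (F.plaqueForm θ x) (F.chart x x).1 (F.leafCoord x x ξ) =
      mfderiv I 𝓘(ℝ, P →L[ℝ] ℝ) (fun y => (trivializationAt (P →L[ℝ] ℝ) F.Cotangent x
          (TotalSpace.mk' (P →L[ℝ] ℝ) y (θ y))).2) x (F.incl x ξ) := by
  obtain ⟨D, hD, hD'⟩ := F.exists_hasFDerivAt_plaqueForm hθ x
  rw [hD.fderiv, hD']
  have hx := F.mem_chart_source x
  have h : F.chartDerivSymm x x (F.leafCoord x x ξ, 0) = F.incl x ξ := by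
    rw [← F.incl_leafFrame hx, F.leafFrame_leafCoord hx]
  rw [h]

/-! ### The presymplectic form on `T*F ⊕ V` in coordinates -/

section Canonical

variable [IsManifold I ∞ M]
  (B : Type*) [NormedAddCommGroup B] [NormedSpace ℝ B] (V : M → Type*)
  [TopologicalSpace (TotalSpace B V)] [∀ x, AddCommGroup (V x)] [∀ x, Module ℝ (V x)]
  [∀ x, TopologicalSpace (V x)] [FiberBundle B V] [VectorBundle ℝ B V]
  [ContMDiffVectorBundle ∞ B V I]

/-- The derivative of `T*F ⊕ V → T*F` along the leaves. -/
def leafFstProj (z : TotalSpace ((P →L[ℝ] ℝ) × B) (F.Cotangent ×ᵇ V)) :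
    (F.characteristicFoliation B V).Tangent z →L[ℝ] F.cotangentFoliation.Tangent (F.fstProj B V z) :=
  F.cotangentFoliation.restrict
      ((mfderiv (I.prod 𝓘(ℝ, (P →L[ℝ] ℝ) × B)) (I.prod 𝓘(ℝ, P →L[ℝ] ℝ)) (F.fstProj B V) z).comp
        ((F.characteristicFoliation B V).incl z))
      (F.mfderiv_fstProj_mem B V z)

lemma tangentProj_leafFstProj (z : TotalSpace ((P →L[ℝ] ℝ) × B) (F.Cotangent ×ᵇ V))
    (X : (F.characteristicFoliation B V).Tangent z) :
    F.tangentProj (P →L[ℝ] ℝ) F.Cotangent (F.fstProj B V z) (F.leafFstProj B V z X) =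
      F.tangentProj ((P →L[ℝ] ℝ) × B) (F.Cotangent ×ᵇ V) z X := by
  apply F.incl_injective
  have h := mfderiv_comp z (I'' := I)
    ((contMDiffAt_proj (n := ∞) (IB := I) (F.Cotangent)
      (p := F.fstProj B V z)).mdifferentiableAt (by simp))
    ((F.contMDiff_fstProj B V z).mdifferentiableAt (by simp))
  exact (DFunLike.congr_fun h ((F.characteristicFoliation B V).incl z X)).symm

/-- The direct sum is trivialized factor by factor, so in coordinates the projection is `(q, (p, b))
↦ (q, p)`. -/
lemma leafCoord_leafFstProj (z : TotalSpace ((P →L[ℝ] ℝ) × B) (F.Cotangent ×ᵇ V))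
    (X : (F.characteristicFoliation B V).Tangent z) :
    F.cotangentFoliation.leafCoord (F.fstProj B V z) (F.fstProj B V z) (F.leafFstProj B V z X) =
      (((F.characteristicFoliation B V).leafCoord z z X).1,
        ((F.characteristicFoliation B V).leafCoord z z X).2.1) := by
  have hz := (F.characteristicFoliation B V).mem_chart_source z
  have hz' := F.cotangentFoliation.mem_chart_source (F.fstProj B V z)
  refine Prod.ext ?_ ?_
  · rw [F.leafCoord_pullback_fst _ _ hz', F.tangentProj_leafFstProj,
      F.leafCoord_pullback_fst _ _ hz]
    rfl
  · rw [F.leafCoord_pullback_snd _ _ hz', F.leafCoord_pullback_snd _ _ hz]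
    have hb := mdifferentiableAt_trivializationAt_snd (I := I) ((P →L[ℝ] ℝ) × B)
      (F.Cotangent ×ᵇ V) (x := z.1) (z := z) (mem_baseSet_trivializationAt _ _ z.1)
    have hb' := mdifferentiableAt_trivializationAt_snd (I := I) (P →L[ℝ] ℝ)
      F.Cotangent (x := z.1) (z := F.fstProj B V z) (mem_baseSet_trivializationAt _ _ z.1)
    have h := mfderiv_comp z hb' ((F.contMDiff_fstProj B V z).mdifferentiableAt (by simp))
    have h2 := DFunLike.congr_fun h ((F.characteristicFoliation B V).incl z X)
    have h3 := mfderiv_fst_apply hb ((F.characteristicFoliation B V).incl z X)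
    exact h2.symm.trans h3.symm

lemma presymplecticForm_apply (z : TotalSpace ((P →L[ℝ] ℝ) × B) (F.Cotangent ×ᵇ V))
    (X Y : (F.characteristicFoliation B V).Tangent z) :
    F.presymplecticForm B V z ![X, Y] =
      ((F.characteristicFoliation B V).leafCoord z z X).2.1
        ((F.characteristicFoliation B V).leafCoord z z Y).1 -
      ((F.characteristicFoliation B V).leafCoord z z Y).2.1
        ((F.characteristicFoliation B V).leafCoord z z X).1 := by
  have h : F.presymplecticForm B V z ![X, Y] = F.symplecticForm (F.fstProj B V z)
      ![F.leafFstProj B V z X, F.leafFstProj B V z Y] := by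
    rw [presymplecticForm, ContinuousAlternatingMap.compContinuousLinearMap_apply]
    congr 1
    ext i; fin_cases i <;> rfl
  rw [h, F.symplecticForm_apply, F.leafCoord_leafFstProj, F.leafCoord_leafFstProj]

/-- The kernel of the presymplectic form consists of the vectors tangent to the fibers of `V`. -/
lemma mem_kernelSpace_canonicalDirac (z : TotalSpace ((P →L[ℝ] ℝ) × B) (F.Cotangent ×ᵇ V))
    (v : TangentSpace (I.prod 𝓘(ℝ, (P →L[ℝ] ℝ) × B)) z) :
    v ∈ kernelSpace (I.prod 𝓘(ℝ, (P →L[ℝ] ℝ) × B)) (F.canonicalDirac B V) z ↔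
      ∃ b : B, (F.characteristicFoliation B V).incl z
        ((F.characteristicFoliation B V).leafFrame z z (0, (0, b))) = v := by
  set G := F.characteristicFoliation B V
  have hz := G.mem_chart_source z
  refine (G.mem_kernelSpace_diracOfForm _ v).trans ?_
  constructor
  · rintro ⟨X, rfl, hX⟩
    refine ⟨(G.leafCoord z z X).2.2, ?_⟩
    -- Test `X` against the frame vector with coordinates `w`. Taking `w = (0, (p, 0))` shows that
    -- every functional `p` kills `q_X`, so `q_X = 0`; taking `w = (a, 0)` then gives `p_X = 0`.
    have h : ∀ w : P × ((P →L[ℝ] ℝ) × B), (G.leafCoord z z X).2.1 w.1 =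
        w.2.1 (G.leafCoord z z X).1 := fun w => by
      have := hX (G.leafFrame z z w)
      rw [F.presymplecticForm_apply, G.leafCoord_leafFrame hz] at this
      exact sub_eq_zero.1 this
    have h1 : (G.leafCoord z z X).1 = 0 :=
      SeparatingDual.eq_zero_of_forall_dual_eq_zero (R := ℝ) fun p => by
        simpa using (h (0, (p, 0))).symm
    have h2 : (G.leafCoord z z X).2.1 = 0 :=
      ContinuousLinearMap.ext fun a => by simpa using h (a, 0)
    rw [← h1, ← h2]
    exact congrArg _ (G.leafFrame_leafCoord hz X)
  · rintro ⟨b, rfl⟩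
    refine ⟨_, rfl, fun Y => ?_⟩
    rw [F.presymplecticForm_apply, G.leafCoord_leafFrame hz]
    simp

lemma finrank_kernelSpace_canonicalDirac
    (z : TotalSpace ((P →L[ℝ] ℝ) × B) (F.Cotangent ×ᵇ V)) :
    Module.finrank ℝ (kernelSpace (I.prod 𝓘(ℝ, (P →L[ℝ] ℝ) × B)) (F.canonicalDirac B V) z) =
      Module.finrank ℝ B := by
  set G := F.characteristicFoliation B V
  have hz := G.mem_chart_source z
  let f : B →ₗ[ℝ] TangentSpace (I.prod 𝓘(ℝ, (P →L[ℝ] ℝ) × B)) z :=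
    ((G.incl z).comp ((G.leafFrame z z).comp ((ContinuousLinearMap.inr ℝ P _).comp
      (ContinuousLinearMap.inr ℝ (P →L[ℝ] ℝ) B)))).toLinearMap
  have hf : kernelSpace (I.prod 𝓘(ℝ, (P →L[ℝ] ℝ) × B)) (F.canonicalDirac B V) z = f.range := by
    ext v
    exact F.mem_kernelSpace_canonicalDirac B V z v
  rw [hf, LinearMap.finrank_range_of_inj]
  intro b b' h
  have h' : G.leafCoord z z (G.leafFrame z z (0, (0, b))) =
      G.leafCoord z z (G.leafFrame z z (0, (0, b'))) :=
    congrArg (G.leafCoord z z) (G.incl_injective z h)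
  rw [G.leafCoord_leafFrame hz, G.leafCoord_leafFrame hz] at h'
  exact congrArg (fun w => w.2.2) h'

/-- The presymplectic form on the derivative of a section is the leafwise exterior derivative of
the component of the section in `T*F`. -/
lemma presymplecticForm_section {K : ∀ x, (F.Cotangent ×ᵇ V) x}
    (hK : ContMDiff I (I.prod 𝓘(ℝ, (P →L[ℝ] ℝ) × B)) ∞
      fun x => TotalSpace.mk' ((P →L[ℝ] ℝ) × B) x (K x)) {x : M} (ξ η : F.Tangent x)
    (X Y : (F.characteristicFoliation B V).Tangent (TotalSpace.mk' ((P →L[ℝ] ℝ) × B) x (K x)))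
    (hX : (F.characteristicFoliation B V).incl _ X = mfderiv I (I.prod 𝓘(ℝ, (P →L[ℝ] ℝ) × B))
      (fun x => TotalSpace.mk' ((P →L[ℝ] ℝ) × B) x (K x)) x (F.incl x ξ))
    (hY : (F.characteristicFoliation B V).incl _ Y = mfderiv I (I.prod 𝓘(ℝ, (P →L[ℝ] ℝ) × B))
      (fun x => TotalSpace.mk' ((P →L[ℝ] ℝ) × B) x (K x)) x (F.incl x η)) :
    F.presymplecticForm B V _ ![X, Y] = F.leafwiseExtDeriv (fun x => (K x).1) x ![ξ, η] := by
  have hθ : ContMDiff I (I.prod 𝓘(ℝ, P →L[ℝ] ℝ)) ∞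
      fun x => TotalSpace.mk' (P →L[ℝ] ℝ) x (K x).1 := (F.contMDiff_fstProj B V).comp hK
  obtain ⟨D, hD, -⟩ := F.exists_hasFDerivAt_plaqueForm hθ x
  rw [F.presymplecticForm_apply, F.leafCoord_section _ hK ξ X hX, F.leafCoord_section _ hK η Y hY,
    F.leafwiseExtDeriv_apply hD.differentiableAt,
    F.fderiv_plaqueForm_leafCoord hθ, F.fderiv_plaqueForm_leafCoord hθ]
  -- It remains to identify the `T*F`-component of the derivative of the fiber coordinates of `K`
  -- with the derivative of those of `θ`.
  have hg : MDifferentiableAt I 𝓘(ℝ, (P →L[ℝ] ℝ) × B) (fun y => (trivializationAt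
      ((P →L[ℝ] ℝ) × B) (F.Cotangent ×ᵇ V) x (TotalSpace.mk' ((P →L[ℝ] ℝ) × B) y (K y))).2) x :=
    ((contMDiffAt_section x).1 (hK x)).mdifferentiableAt (by simp)
  have h := fun ζ : F.Tangent x => mfderiv_fst_apply hg (F.incl x ζ)
  exact congrArg₂ (fun p q : P →L[ℝ] ℝ => p (F.leafCoord x x η) - q (F.leafCoord x x ξ))
    (h ξ) (h η)

end Canonical

end RegularFoliation

/-! ### Smooth sections are embeddings -/

section Shear

variable {E : Type*} [NormedAddCommGroup E] [NormedSpace ℝ E]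
  {H : Type*} [TopologicalSpace H] {I : ModelWithCorners ℝ E H}
  {M : Type*} [TopologicalSpace M] [ChartedSpace H M]
  {A : Type*} [NormedAddCommGroup A] [NormedSpace ℝ A]

/-- The map `(y, a) ↦ (y, a - g y)` over an open set `U`. -/
def shear {U : Set M} (hU : IsOpen U) {g : M → A} (hg : ContinuousOn g U) :
    OpenPartialHomeomorph (M × A) (M × A) where
  toFun p := (p.1, p.2 - g p.1)
  invFun p := (p.1, p.2 + g p.1)
  source := U ×ˢ univ
  target := U ×ˢ univ
  map_source' _ hp := ⟨hp.1, mem_univ _⟩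
  map_target' _ hp := ⟨hp.1, mem_univ _⟩
  left_inv' _ _ := by simp
  right_inv' _ _ := by simp
  open_source := hU.prod isOpen_univ
  open_target := hU.prod isOpen_univ
  continuousOn_toFun := continuousOn_fst.prodMk
    (continuousOn_snd.sub (hg.comp continuousOn_fst fun _ hp => hp.1))
  continuousOn_invFun := continuousOn_fst.prodMk
    (continuousOn_snd.add (hg.comp continuousOn_fst fun _ hp => hp.1))

lemma contMDiffOn_shear {U : Set M} (hU : IsOpen U) {g : M → A}
    (hg : ContMDiffOn I 𝓘(ℝ, A) ∞ g U) :
    ContMDiffOn (I.prod 𝓘(ℝ, A)) (I.prod 𝓘(ℝ, A)) ∞ (shear hU hg.continuousOn)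
      (shear hU hg.continuousOn).source :=
  contMDiffOn_fst.prodMk (contMDiffOn_snd.sub (hg.comp contMDiffOn_fst fun _ hp => hp.1))

lemma contMDiffOn_shear_symm {U : Set M} (hU : IsOpen U) {g : M → A}
    (hg : ContMDiffOn I 𝓘(ℝ, A) ∞ g U) :
    ContMDiffOn (I.prod 𝓘(ℝ, A)) (I.prod 𝓘(ℝ, A)) ∞ (shear hU hg.continuousOn).symm
      (shear hU hg.continuousOn).target :=
  contMDiffOn_fst.prodMk (contMDiffOn_snd.add (hg.comp contMDiffOn_fst fun _ hp => hp.1))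

end Shear

section Embedding

variable {E : Type*} [NormedAddCommGroup E] [NormedSpace ℝ E]
  {H : Type*} [TopologicalSpace H] {I : ModelWithCorners ℝ E H}
  {M : Type*} [TopologicalSpace M] [ChartedSpace H M] [IsManifold I ∞ M]
  (A : Type*) [NormedAddCommGroup A] [NormedSpace ℝ A] {W : M → Type*}
  [TopologicalSpace (TotalSpace A W)] [∀ x, AddCommGroup (W x)] [∀ x, Module ℝ (W x)]
  [∀ x, TopologicalSpace (W x)] [FiberBundle A W] [VectorBundle ℝ A W]
  [ContMDiffVectorBundle ∞ A W I] {s : ∀ x, W x}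

/-- A smooth section of a vector bundle is an immersion. -/
lemma isImmersionAtOfComplement_section
    (hs : ContMDiff I (I.prod 𝓘(ℝ, A)) ∞ fun x => TotalSpace.mk' A x (s x)) (x : M) :
    Manifold.IsImmersionAtOfComplement A I (I.prod 𝓘(ℝ, A)) ∞
      (fun x => TotalSpace.mk' A x (s x)) x := by
  set e := trivializationAt A W x
  have hx : x ∈ e.baseSet := mem_baseSet_trivializationAt A W x
  have hg : ContMDiffOn I 𝓘(ℝ, A) ∞ (fun y => (e (TotalSpace.mk' A y (s y))).2) e.baseSet :=
    contMDiffOn_snd.comp (t := univ) ((e.contMDiffOn (IB := I) (n := ∞)).comp hs.contMDiffOn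
      fun y hy => (Trivialization.mem_source _).2 hy) fun _ _ => mem_univ _
  let σ := shear e.open_baseSet hg.continuousOn
  let c : OpenPartialHomeomorph (M × A) (ModelProd H A) :=
    (chartAt H x).prod (OpenPartialHomeomorph.refl A)
  have hc : c ∈ IsManifold.maximalAtlas (I.prod 𝓘(ℝ, A)) ∞ (M × A) :=
    IsManifold.mem_maximalAtlas_prod (IsManifold.chart_mem_maximalAtlas x)
      (IsManifold.chart_mem_maximalAtlas (I := 𝓘(ℝ, A)) (0 : A))
  -- This chart of the total space straightens the section: trivialize, subtract the local
  -- expression of `s`, and apply a chart of the base. The image of `s` becomes the zero slice, so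
  -- `s` reads `u ↦ (u, 0)`.
  let ψ : OpenPartialHomeomorph (TotalSpace A W) (ModelProd H A) :=
    (e.toOpenPartialHomeomorph ≫ₕ σ) ≫ₕ c
  have hψs : ∀ y ∈ e.baseSet, y ∈ (chartAt H x).source →
      TotalSpace.mk' A y (s y) ∈ ψ.source ∧
        ψ (TotalSpace.mk' A y (s y)) = (chartAt H x y, (0 : A)) := by
    intro y hy hy'
    have h1 : (e (TotalSpace.mk' A y (s y))).1 = y := e.coe_fst' hy
    have h2 : (e.toOpenPartialHomeomorph ≫ₕ σ) (TotalSpace.mk' A y (s y)) = (y, 0) := by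
      change ((e (TotalSpace.mk' A y (s y))).1, (e (TotalSpace.mk' A y (s y))).2 -
        (e (TotalSpace.mk' A _ (s (e (TotalSpace.mk' A y (s y))).1))).2) = _
      rw [h1, sub_self]
    refine ⟨⟨⟨(Trivialization.mem_source _).2 hy, ?_, mem_univ _⟩, ?_⟩, ?_⟩
    · exact h1.symm ▸ hy
    · change (e.toOpenPartialHomeomorph ≫ₕ σ) (TotalSpace.mk' A y (s y)) ∈ c.source
      rw [h2]
      exact ⟨hy', mem_univ _⟩
    · change c ((e.toOpenPartialHomeomorph ≫ₕ σ) (TotalSpace.mk' A y (s y))) = _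
      rw [h2]; rfl
  have hψ : ψ ∈ IsManifold.maximalAtlas (I.prod 𝓘(ℝ, A)) ∞ (TotalSpace A W) := by
    refine OpenPartialHomeomorph.mem_maximalAtlas_of_contMDiffOn ψ ?_ ?_
    · refine (contMDiffOn_of_mem_maximalAtlas hc).comp (t := c.source)
        (((contMDiffOn_shear e.open_baseSet hg).comp
          ((e.contMDiffOn (IB := I) (n := ∞)).mono ?_) ?_)) ?_
      · exact fun w hw => hw.1.1
      · exact fun w hw => hw.1.2
      · exact fun w hw => hw.2
    · refine (e.contMDiffOn_symm (IB := I) (n := ∞)).comp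
        ((contMDiffOn_shear_symm e.open_baseSet hg).comp
          ((contMDiffOn_symm_of_mem_maximalAtlas hc).mono ?_) ?_) ?_
      · exact fun w hw => hw.1
      · exact fun w hw => hw.2.1
      · exact fun w hw => hw.2.2
  -- The base chart is restricted to the base set of the trivialization, because `ψ` straightens `s`
  -- only there.
  refine Manifold.IsImmersionAtOfComplement.mk_of_continuousAt (hs x).continuousAt
    (ContinuousLinearEquiv.refl ℝ (E × A)) ((chartAt H x).restr e.baseSet) ψ ?_ ?_ ?_ hψ ?_
  · rw [OpenPartialHomeomorph.restr_source, e.open_baseSet.interior_eq]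
    exact ⟨mem_chart_source H x, hx⟩
  · exact (hψs x hx (mem_chart_source H x)).1
  · exact restr_mem_maximalAtlas (contDiffGroupoid ∞ I)
      (IsManifold.chart_mem_maximalAtlas x) e.open_baseSet
  · intro u hu
    set d := (chartAt H x).restr e.baseSet
    have hy : (d.extend I).symm u ∈ d.source := by
      have := (d.extend I).map_target hu
      rwa [OpenPartialHomeomorph.extend_source] at this
    have hu' : d.extend I ((d.extend I).symm u) = u := (d.extend I).right_inv hu
    set y := (d.extend I).symm u
    rw [OpenPartialHomeomorph.restr_source, e.open_baseSet.interior_eq] at hy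
    change ψ.extend (I.prod 𝓘(ℝ, A)) (TotalSpace.mk' A y (s y)) = (u, (0 : A))
    rw [OpenPartialHomeomorph.extend_coe, Function.comp_apply, (hψs y hy.2 hy.1).2]
    exact Prod.ext hu' rfl

/-- A smooth section of a vector bundle is a smooth embedding. -/
lemma isSmoothEmbedding_section
    (hs : ContMDiff I (I.prod 𝓘(ℝ, A)) ∞ fun x => TotalSpace.mk' A x (s x)) :
    Manifold.IsSmoothEmbedding I (I.prod 𝓘(ℝ, A)) ∞ fun x => TotalSpace.mk' A x (s x) where
  isImmersion := Manifold.IsImmersionOfComplement.isImmersion (F := A)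
    fun x => isImmersionAtOfComplement_section A hs x
  isEmbedding := .of_leftInverse (f := π A W) (fun _ => rfl)
    (FiberBundle.continuous_proj A W) hs.continuous

end Embedding

/-! ### The co-Lagrangian conditions for a section -/

namespace RegularFoliation

variable {E : Type*} [NormedAddCommGroup E] [NormedSpace ℝ E]
  {H : Type*} [TopologicalSpace H] {I : ModelWithCorners ℝ E H}
  {P Q : Type*} [NormedAddCommGroup P] [NormedSpace ℝ P]
  [NormedAddCommGroup Q] [NormedSpace ℝ Q]
  {M : Type*} [TopologicalSpace M] [ChartedSpace H M] [IsManifold I ∞ M]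
  (F : RegularFoliation I P Q M)
  (B : Type*) [NormedAddCommGroup B] [NormedSpace ℝ B] (V : M → Type*)
  [TopologicalSpace (TotalSpace B V)] [∀ x, AddCommGroup (V x)] [∀ x, Module ℝ (V x)]
  [∀ x, TopologicalSpace (V x)] [FiberBundle B V] [VectorBundle ℝ B V]
  [ContMDiffVectorBundle ∞ B V I]

/-- The image of a section is transverse to the kernel of the canonical Dirac structure. -/
lemma range_section_inf_kernelSpace {K : ∀ x, (F.Cotangent ×ᵇ V) x}
    (hK : ContMDiff I (I.prod 𝓘(ℝ, (P →L[ℝ] ℝ) × B)) ∞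
      fun x => TotalSpace.mk' ((P →L[ℝ] ℝ) × B) x (K x)) (x : M) :
    (mfderiv I (I.prod 𝓘(ℝ, (P →L[ℝ] ℝ) × B))
      (fun x => TotalSpace.mk' ((P →L[ℝ] ℝ) × B) x (K x)) x).range ⊓
      kernelSpace (I.prod 𝓘(ℝ, (P →L[ℝ] ℝ) × B)) (F.canonicalDirac B V)
        (TotalSpace.mk' ((P →L[ℝ] ℝ) × B) x (K x)) = ⊥ := by
  rw [eq_bot_iff]
  rintro _ ⟨⟨ξ, rfl⟩, hξ⟩
  obtain ⟨b, hb⟩ := (F.mem_kernelSpace_canonicalDirac B V _ _).1 hξ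
  have hz := (F.characteristicFoliation B V).mem_chart_source
    (TotalSpace.mk' ((P →L[ℝ] ℝ) × B) x (K x))
  -- A kernel vector has zero `q`-part, so `dπ` kills it; but `dπ` sends `dK(ξ)` to `ξ`, which
  -- forces `ξ = 0`.
  have h := congrArg (F.incl x) (F.tangentProj_leafFrame _ (F.Cotangent ×ᵇ V) hz (0, (0, b)))
  rw [map_zero, map_zero] at h
  have h2 : ξ = 0 := by
    rw [← mfderiv_proj_section _ hK x ξ, ← h]
    exact congrArg _ hb.symm
  rw [h2]
  exact (mfderiv I (I.prod 𝓘(ℝ, (P →L[ℝ] ℝ) × B))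
    (fun x => TotalSpace.mk' ((P →L[ℝ] ℝ) × B) x (K x)) x).map_zero

variable [FiniteDimensional ℝ E] [FiniteDimensional ℝ P] [FiniteDimensional ℝ B]

/-- The canonical Dirac structure is regular of bi-corank `(rank V, codim F)`. -/
lemma isRegularOfBicorank_canonicalDirac [FiniteDimensional ℝ Q] :
    IsRegularOfBicorank (I.prod 𝓘(ℝ, (P →L[ℝ] ℝ) × B)) (F.canonicalDirac B V)
      (Module.finrank ℝ B) (Module.finrank ℝ Q) where
  isotropic z p hp q hq := by
    have h : p.2 q.1 + q.2 p.1 = 0 :=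
      (F.characteristicFoliation B V).diracOfForm_isotropic (F.presymplecticForm B V) p q hp hq
    rw [h, mul_zero]
  finrank_eq z := (F.characteristicFoliation B V).finrank_diracOfForm (F.presymplecticForm B V) z
  finrank_inter_tangent z := F.finrank_kernelSpace_canonicalDirac B V z
  finrank_inter_cotangent z :=
    (F.characteristicFoliation B V).finrank_diracOfForm_inter_cotangent
      (F.presymplecticForm B V) z

lemma characteristicSpace_canonicalDirac
    (z : TotalSpace ((P →L[ℝ] ℝ) × B) (F.Cotangent ×ᵇ V)) :
    characteristicSpace (I.prod 𝓘(ℝ, (P →L[ℝ] ℝ) × B)) (F.canonicalDirac B V) z =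
      (F.characteristicFoliation B V).tangent z :=
  (F.characteristicFoliation B V).characteristicSpace_diracOfForm (F.presymplecticForm B V) z

section Section

variable {B V} {K : ∀ x, (F.Cotangent ×ᵇ V) x}

/-- The image of a section is transverse to the characteristic leaves. -/
lemma range_section_sup_characteristicSpace
    (hK : ContMDiff I (I.prod 𝓘(ℝ, (P →L[ℝ] ℝ) × B)) ∞
      fun x => TotalSpace.mk' ((P →L[ℝ] ℝ) × B) x (K x)) (x : M) :
    (mfderiv I (I.prod 𝓘(ℝ, (P →L[ℝ] ℝ) × B))
      (fun x => TotalSpace.mk' ((P →L[ℝ] ℝ) × B) x (K x)) x).range ⊔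
      characteristicSpace (I.prod 𝓘(ℝ, (P →L[ℝ] ℝ) × B)) (F.canonicalDirac B V)
        (TotalSpace.mk' ((P →L[ℝ] ℝ) × B) x (K x)) = ⊤ := by
  rw [F.characteristicSpace_canonicalDirac, eq_top_iff]
  set z : TotalSpace ((P →L[ℝ] ℝ) × B) (F.Cotangent ×ᵇ V) :=
    TotalSpace.mk' ((P →L[ℝ] ℝ) × B) x (K x)
  set dK := mfderiv I (I.prod 𝓘(ℝ, (P →L[ℝ] ℝ) × B))
      (fun x => TotalSpace.mk' ((P →L[ℝ] ℝ) × B) x (K x)) x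
  set dp := mfderiv (I.prod 𝓘(ℝ, (P →L[ℝ] ℝ) × B)) I
    (π ((P →L[ℝ] ℝ) × B) (F.Cotangent ×ᵇ V)) z
  intro w _
  -- The remainder `w - dK (dp w)` is vertical because `dp ∘ dK = id`, hence tangent to the leaf.
  refine Submodule.mem_sup.2 ⟨dK (dp w), ⟨_, rfl⟩, w - dK (dp w), ?_, add_sub_cancel _ _⟩
  change dp (w - dK (dp w)) ∈ F.tangent x
  have h : dp (dK (dp w)) = dp w := mfderiv_proj_section _ hK x (dp w)
  have h' : dp (w - dK (dp w)) = 0 := (dp.map_sub _ _).trans (sub_eq_zero.2 h.symm)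
  rw [h']
  exact zero_mem _

/-- The image of a section is isotropic in the characteristic leaves if and only if the component
of the section in `T*F` is closed along the leaves. -/
lemma section_isotropic_iff
    (hK : ContMDiff I (I.prod 𝓘(ℝ, (P →L[ℝ] ℝ) × B)) ∞
      fun x => TotalSpace.mk' ((P →L[ℝ] ℝ) × B) x (K x)) (x : M) :
    (∀ X ∈ (mfderiv I (I.prod 𝓘(ℝ, (P →L[ℝ] ℝ) × B))
        (fun x => TotalSpace.mk' ((P →L[ℝ] ℝ) × B) x (K x)) x).range,
      ∀ Y ∈ (mfderiv I (I.prod 𝓘(ℝ, (P →L[ℝ] ℝ) × B))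
        (fun x => TotalSpace.mk' ((P →L[ℝ] ℝ) × B) x (K x)) x).range,
      Y ∈ characteristicSpace (I.prod 𝓘(ℝ, (P →L[ℝ] ℝ) × B)) (F.canonicalDirac B V)
        (TotalSpace.mk' ((P →L[ℝ] ℝ) × B) x (K x)) →
      ∀ α : TangentSpace (I.prod 𝓘(ℝ, (P →L[ℝ] ℝ) × B))
          (TotalSpace.mk' ((P →L[ℝ] ℝ) × B) x (K x)) →L[ℝ] ℝ,
        (X, α) ∈ F.canonicalDirac B V (TotalSpace.mk' ((P →L[ℝ] ℝ) × B) x (K x)) → α Y = 0) ↔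
      F.leafwiseExtDeriv (fun x => (K x).1) x = 0 := by
  rw [F.characteristicSpace_canonicalDirac]
  set G := F.characteristicFoliation B V
  constructor
  · intro h
    ext v
    have hv : v = ![v 0, v 1] := by ext i; fin_cases i <;> rfl
    rw [hv]
    have hX := (F.mfderiv_section_mem_iff _ hK _).2 (F.incl_mem x (v 0))
    have hY := (F.mfderiv_section_mem_iff _ hK _).2 (F.incl_mem x (v 1))
    -- Condition (c) is phrased through covectors `α`, so one representing `ω_S(X, ·)` has to be
    -- produced before it can be applied.
    obtain ⟨α, hα⟩ := G.exists_mem_diracOfForm (F.presymplecticForm B V) ⟨_, hX⟩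
    rw [← F.presymplecticForm_section B V hK (v 0) (v 1) ⟨_, hX⟩ ⟨_, hY⟩ rfl rfl]
    exact ((G.mem_diracOfForm_incl (F.presymplecticForm B V) ⟨_, hX⟩ α).1 hα ⟨_, hY⟩).symm.trans
      (h _ ⟨_, rfl⟩ _ ⟨_, rfl⟩ hY α hα)
  · rintro h _ ⟨ξ, rfl⟩ _ ⟨η, rfl⟩ hY α hα
    obtain ⟨X, hX, hα⟩ := hα
    -- Membership of `(dK ξ, α)` in the Dirac structure already makes `dK ξ` tangent to the leaf,
    -- hence `ξ` too.
    have hξ : ξ ∈ F.tangent x :=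
      (F.mfderiv_section_mem_iff _ hK ξ).1 (by
        have h1 := G.incl_mem _ X
        rwa [hX] at h1)
    have hη : η ∈ F.tangent x := (F.mfderiv_section_mem_iff _ hK η).1 hY
    have h2 := hα ⟨_, hY⟩
    rw [F.presymplecticForm_section B V hK ⟨ξ, hξ⟩ ⟨η, hη⟩ X ⟨_, hY⟩ hX rfl, h] at h2
    exact h2

end Section

end RegularFoliation

end

/-! ### The characterization of co-Lagrangian sections -/

theorem mainTheorem8
    {E : Type*} [NormedAddCommGroup E] [NormedSpace ℝ E] [FiniteDimensional ℝ E]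
    {L : Type*} [TopologicalSpace L] [ChartedSpace E L] [IsManifold 𝓘(ℝ, E) ∞ L]
    {P Q : Type*} [NormedAddCommGroup P] [NormedSpace ℝ P] [FiniteDimensional ℝ P]
    [NormedAddCommGroup Q] [NormedSpace ℝ Q] [FiniteDimensional ℝ Q]
    (F : RegularFoliation 𝓘(ℝ, E) P Q L)
    {B : Type*} [NormedAddCommGroup B] [NormedSpace ℝ B] [FiniteDimensional ℝ B]
    (V : L → Type*) [TopologicalSpace (TotalSpace B V)] [∀ x, AddCommGroup (V x)]
    [∀ x, Module ℝ (V x)] [∀ x, TopologicalSpace (V x)] [FiberBundle B V] [VectorBundle ℝ B V]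
    [ContMDiffVectorBundle ∞ B V 𝓘(ℝ, E)]
    (K : Cₛ^∞⟮𝓘(ℝ, E); (P →L[ℝ] ℝ) × B, F.Cotangent ×ᵇ V⟯) :
    IsCoLagrangian (𝓘(ℝ, E).prod 𝓘(ℝ, (P →L[ℝ] ℝ) × B)) 𝓘(ℝ, E) (F.canonicalDirac B V)
        (fun x => (⟨x, K x⟩ : TotalSpace ((P →L[ℝ] ℝ) × B) (F.Cotangent ×ᵇ V))) ↔
      ∃ (θ : Cₛ^∞⟮𝓘(ℝ, E); P →L[ℝ] ℝ, F.Cotangent⟯) (v : Cₛ^∞⟮𝓘(ℝ, E); B, V⟯),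
        (∀ x, F.leafwiseExtDeriv θ x = 0) ∧ ∀ x, K x = (θ x, v x) := by
  have hK : ContMDiff 𝓘(ℝ, E) (𝓘(ℝ, E).prod 𝓘(ℝ, (P →L[ℝ] ℝ) × B)) ∞
      fun x => TotalSpace.mk' ((P →L[ℝ] ℝ) × B) x (K x) := K.contMDiff
  constructor
  · rintro ⟨r, s, h⟩
    refine ⟨⟨fun x => (K x).1, (F.contMDiff_fstProj B V).comp hK⟩, ⟨fun x => (K x).2, fun x => ?_⟩,
      fun x => (F.section_isotropic_iff hK x).1 (h.isotropic x), fun x => rfl⟩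
    -- Smoothness of `v` is read in the trivialization of the direct sum, whose second component is
    -- that of `V`.
    have h1 := (contMDiffAt_section x).1 (hK x)
    have h2 : ContMDiff 𝓘(ℝ, (P →L[ℝ] ℝ) × B) 𝓘(ℝ, B) ∞ (Prod.snd : (P →L[ℝ] ℝ) × B → B) :=
      contDiff_snd.contMDiff
    have h3 := h2.contMDiffAt.comp x h1
    exact (contMDiffAt_section x).2 h3
  · rintro ⟨θ, v, hθ, hKv⟩
    have hθ' : (fun x => (K x).1) = θ := funext fun x => congrArg Prod.fst (hKv x)
    have hreg := F.isRegularOfBicorank_canonicalDirac B V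
    -- Only regularity and the dimension count involve `(r, s)`; the other conditions are settled
    -- once for all values.
    have key : ∀ r s : ℕ, IsRegularOfBicorank (𝓘(ℝ, E).prod 𝓘(ℝ, (P →L[ℝ] ℝ) × B))
        (F.canonicalDirac B V) r s → (Module.finrank ℝ E : ℝ) =
          (1 / 2) * (Module.finrank ℝ (E × ((P →L[ℝ] ℝ) × B)) - r + s) →
        IsCoLagrangian (𝓘(ℝ, E).prod 𝓘(ℝ, (P →L[ℝ] ℝ) × B)) 𝓘(ℝ, E) (F.canonicalDirac B V)
          (fun x => (⟨x, K x⟩ : TotalSpace ((P →L[ℝ] ℝ) × B) (F.Cotangent ×ᵇ V))) :=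
      fun r s hr hd => ⟨r, s, hr, isSmoothEmbedding_section _ hK, hd,
        F.range_section_sup_characteristicSpace hK, F.range_section_inf_kernelSpace B V hK,
        fun x => (F.section_isotropic_iff hK x).2 (hθ'.symm ▸ hθ x)⟩
    have hdim : Module.finrank ℝ (E × ((P →L[ℝ] ℝ) × B)) =
        Module.finrank ℝ E + (Module.finrank ℝ P + Module.finrank ℝ B) := by
      have hP : Module.finrank ℝ (P →L[ℝ] ℝ) = Module.finrank ℝ P :=
        (LinearMap.toContinuousLinearMap (E := P) (F' := ℝ) (𝕜 := ℝ)).finrank_eq.symm.trans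
          Subspace.dual_finrank_eq
      rw [Module.finrank_prod, Module.finrank_prod, hP]
    rcases isEmpty_or_nonempty L with hL | ⟨⟨x⟩⟩
    · have hM : IsEmpty (TotalSpace ((P →L[ℝ] ℝ) × B) (F.Cotangent ×ᵇ V)) :=
        ⟨fun z => hL.false z.1⟩
      -- Over an empty base every `(r, s)` is vacuously a bi-corank, and `E` need not have dimension
      -- `dim P + dim Q`. This pair is chosen to solve `dim E = (dim E + dim P + dim B - r + s) /
      -- 2`.
      refine key (Module.finrank ℝ P + Module.finrank ℝ B) (Module.finrank ℝ E)
        ⟨fun z => (hM.false z).elim, fun z => (hM.false z).elim, fun z => (hM.false z).elim,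
          fun z => (hM.false z).elim⟩ ?_
      rw [hdim]
      push_cast
      ring
    -- With `r = dim B`, `s = dim Q` and `dim E = dim P + dim Q`, both sides equal `dim P + dim Q`.
    · refine key _ _ hreg ?_
      rw [hdim, F.finrank_model_eq x]
      push_cast
      ring
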